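/- \textbf{Setting.} Let $E$ be a real normed space whose Borel $\sigma$-algebra makes it a standard Borel space (for example $\mathbb R^q$ or any separable Banach space), and let $A$ be a nonempty bounded subset of a real normed space which, with its Borel $\sigma$-algebra, is a standard Borel space (for example a Borel subset of $\mathbb R^m$). Write $\mathcal P(S)$ for the probability measures on $S$, with the $\sigma$-algebra generated by the evaluations $\mu\mapsto\mu(B)$; $\|\mu\|_2^2=\int|x|^2\mu(dx)$ for $\mu\in\mathcal P(E)$ or $\mathcal P(A)$; and $\mathcal P_2$ for the set of those $\mu$ with $\|\mu\|_2<\infty$. On a probability space $(\Omega,\mathcal F,\mathbb P)$ let $\varepsilon_1,\varepsilon_2,\dots$ be i.i.d. $\mathbb R^d$-valued random variables, and let $\xi$ be a square integrable $E$-valued random variable independent of $(\varepsilon_k)_{k\ge1}$. Fix a horizon $n\ge1$, measurable maps $F_{k+1}:E\times\mathcal P(E)\times A\times\mathcal P(A)\times\mathbb R^d\to E$ ($k\ge0$) and measurable real costs $f_k(x,\mu,a,\lambda)$ ($0\le k<n$) and $g(x,\mu)$, and let $P_{k+1}(x,\mu,a,\lambda,dx')$ be the law of $F_{k+1}(x,\mu,a,\lambda,\varepsilon_{k+1})$.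 Assume: (H1) for every $k\ge 0$ there is $C>0$ with $\int|x'|^2P_{k+1}(x,\mu,a,\lambda,dx')\le C(1+|x|^2+|a|^2+\|\mu\|_2^2+\|\lambda\|_2^2)$ for all $(x,\mu,a,\lambda)$; (H2) there is $C>0$ with $|g(x,\mu)|\le C(1+|x|^2+\|\mu\|_2^2)$, and for every $k<n$ there is $C>0$ with $|f_k(x,\mu,a,\lambda)|\le C(1+|x|^2+|a|^2+\|\mu\|_2^2+\|\lambda\|_2^2)$, for all $x,a$ and all square integrable $\mu,\lambda$. Let $A^E$ be the set of measurable $\tilde\alpha:E\to A$ with linear growth and $\tilde\alpha\star\mu$ the image of $\mu$ under $\tilde\alpha$. Put $$\hat f_k(\mu,\tilde\alpha)=\int_E f_k(x,\mu,\tilde\alpha(x),\tilde\alpha\star\mu)\,\mu(dx),\qquad \hat g(\mu)=\int_E g(x,\mu)\,\mu(dx),$$ $$\Phi_{k+1}(\mu,\tilde\alpha)(dx')=\int_E\mu(dx)\,P_{k+1}(x,\mu,\tilde\alpha(x),\tilde\alpha\star\mu,dx'),$$ and define the value functions by $v_n=\hat g$ and $$v_k(\mu)=\inf_{\tilde\alpha\in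 A^E}\big[\hat f_k(\mu,\tilde\alpha)+v_{k+1}(\Phi_{k+1}(\mu,\tilde\alpha))\big]\in[-\infty,\infty],\qquad 0\le k<n,\ \mu\in\mathcal P_2(E).$$ For a sequence $\alpha=(\tilde\alpha_k)_{k\ge0}$ in $A^E$ let $X^\alpha_0=\xi$, $X^\alpha_{k+1}=F_{k+1}(X^\alpha_k,\mathbb P_{X^\alpha_k},\alpha_k,\mathbb P_{\alpha_k},\varepsilon_{k+1})$ with $\alpha_k=\tilde\alpha_k(X^\alpha_k)$, where $\mathbb P_Y$ is the law of $Y$, and let $V_k^\alpha$ be the infimum of $\sum_{j=k}^{n-1}\hat f_j(\mathbb P_{X_j^\beta},\tilde\beta_j)+\hat g(\mathbb P_{X_n^\beta})$ over all sequences $\beta=(\tilde\beta_j)$ in $A^E$ with $\tilde\beta_j=\tilde\alpha_j$ for $j<k$. \textbf{Claim.} Suppose there is no mean-field interaction, i.e. $F_{k+1}$, $f_k$ and $g$ do not depend on $(\mu,\lambda)$; write them $F_{k+1}(x,a,e)$, $f_k(x,a)$, $g(x)$, and write $P_{k+1}(x,a,dx')$ for the law of $F_{k+1}(x,a,\varepsilon_{k+1})$.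 Then $V_k^\alpha>-\infty$ for all $k=0,\dots,n$ and all $\alpha$, and there are functions $\tilde v_k:E\to\mathbb R$, $k=0,\dots,n$, such that (i) $\tilde v_n=g$ and, for all $k<n$ and $x\in E$, $$\tilde v_k(x)=\inf_{a\in A}\Big[f_k(x,a)+\int_E\tilde v_{k+1}(x')\,P_{k+1}(x,a,dx')\Big],$$ where $\tilde v_{k+1}$ is $P_{k+1}(x,a,\cdot)$-integrable for every $a\in A$ and the infimum is finite; (ii) for every $k=0,\dots,n$ and every $\mu\in\mathcal P_2(E)$, $\tilde v_k$ is $\mu$-integrable and $$v_k(\mu)=\int_E\tilde v_k(x)\,\mu(dx).$$ (Integrals and integrability are with respect to the completion of the measure.) -/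

import Mathlib

open MeasureTheory ProbabilityTheory
open scoped ENNReal NNReal

noncomputable section

namespace McKeanVlasov

/-- The second moment `‖μ‖₂² = ∫ |x|² μ(dx)` of a measure on (a subset of) a normed space, where
`r x` is the norm of the point `x`. -/
def secondMoment {S : Type*} [MeasurableSpace S] (r : S → ℝ≥0∞) (μ : ProbabilityMeasure S) : ℝ≥0∞ :=
  ∫⁻ x, r x ^ 2 ∂(μ : Measure S)

/-- A controlled discrete-time McKean-Vlasov system with state space `E`, control space `A` (a subset
of the normed space `M`), noise in `ℝ^d`, horizon `n`, on a probability space `(Ω, Pr)`.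

Indexing: `F k` and `ε k` stand for `F_{k+1}` and `ε_{k+1}` (the data that move the state from time
`k` to time `k + 1`), while `f k` is the running cost at time `k`.
The costs are given on all probability measures; only their values at square integrable ones matter. -/
structure System {Ω : Type*} [MeasurableSpace Ω] (Pr : Measure Ω)
    (E : Type*) [NormedAddCommGroup E] [MeasurableSpace E]
    {M : Type*} [NormedAddCommGroup M] [MeasurableSpace M] (A : Set M) (d n : ℕ) where
  /-- the dynamics -/
  F : ℕ → E → ProbabilityMeasure E → A → ProbabilityMeasure A → EuclideanSpace ℝ (Fin d) → E
  /-- the running costs -/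
  f : ℕ → E → ProbabilityMeasure E → A → ProbabilityMeasure A → ℝ
  /-- the terminal cost -/
  g : E → ProbabilityMeasure E → ℝ
  /-- the initial state -/
  ξ : Ω → E
  /-- the noise -/
  ε : ℕ → Ω → EuclideanSpace ℝ (Fin d)
  measurable_F : ∀ k, Measurable
    (fun p : E × ProbabilityMeasure E × A × ProbabilityMeasure A × EuclideanSpace ℝ (Fin d) =>
      F k p.1 p.2.1 p.2.2.1 p.2.2.2.1 p.2.2.2.2)
  measurable_f : ∀ k < n, Measurable
    (fun p : E × ProbabilityMeasure E × A × ProbabilityMeasure A =>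
      f k p.1 p.2.1 p.2.2.1 p.2.2.2)
  measurable_g : Measurable (fun p : E × ProbabilityMeasure E => g p.1 p.2)
  measurable_ξ : Measurable ξ
  measurable_ε : ∀ k, Measurable (ε k)
  sq_integrable_ξ : ∫⁻ ω, ‖ξ ω‖ₑ ^ 2 ∂Pr < ∞
  iIndepFun_ε : iIndepFun ε Pr
  identDistrib_ε : ∀ k, IdentDistrib (ε k) (ε 0) Pr Pr
  indepFun_ξ_ε : IndepFun ξ (fun ω k => ε k ω) Pr

section Policy

variable (E : Type*) [NormedAddCommGroup E] [MeasurableSpace E]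
  {M : Type*} [NormedAddCommGroup M] [MeasurableSpace M] (A : Set M)

/-- The set `A^E` of measurable functions from `E` to `A` with linear growth. -/
def Policy : Type _ :=
  {α : E → A // Measurable α ∧ ∃ C : ℝ, ∀ x, ‖(α x : M)‖ ≤ C * (1 + ‖x‖)}

end Policy

section

variable {Ω : Type*} [MeasurableSpace Ω] {Pr : Measure Ω} [IsProbabilityMeasure Pr]
  {E : Type*} [NormedAddCommGroup E] [MeasurableSpace E]
  {M : Type*} [NormedAddCommGroup M] [MeasurableSpace M] {A : Set M} {d n : ℕ}

/-- The law of a random variable. -/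
def law {S : Type*} [MeasurableSpace S] (Pr : Measure Ω) [IsProbabilityMeasure Pr]
    (Y : {Y : Ω → S // Measurable Y}) : ProbabilityMeasure S :=
  ⟨Pr.map Y.1, Measure.isProbabilityMeasure_map Y.2.aemeasurable⟩

/-- The image `α ⋆ μ` of `μ` by the policy `α`. -/
def Policy.push (α : Policy E A) (μ : ProbabilityMeasure E) : ProbabilityMeasure A :=
  μ.map α.2.1.aemeasurable

namespace System

variable (m : System Pr E A d n)

/-- `P k x μ a λ` is the transition probability `P_{k+1}(x, μ, a, λ, dx')`, the law of
`F_{k+1}(x, μ, a, λ, ε_{k+1})`. -/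
def P (k : ℕ) (x : E) (μ : ProbabilityMeasure E) (a : A) (l : ProbabilityMeasure A) : Measure E :=
  Pr.map (fun ω => m.F k x μ a l (m.ε k ω))

/-- Assumption (H1): quadratic growth of the second moment of the transitions. -/
def H1 : Prop :=
  ∀ k, ∃ C : ℝ≥0, 0 < C ∧ ∀ x μ a l,
    ∫⁻ ω, ‖m.F k x μ a l (m.ε k ω)‖ₑ ^ 2 ∂Pr ≤
      C * (1 + ‖x‖ₑ ^ 2 + ‖(a : M)‖ₑ ^ 2 + secondMoment (fun y => ‖y‖ₑ) μ
        + secondMoment (fun b : A => ‖(b : M)‖ₑ) l)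

/-- Assumption (H2): quadratic growth of the costs (on square integrable measures). -/
def H2 : Prop :=
  (∀ k < n, ∃ C : ℝ, 0 < C ∧ ∀ x μ a l,
    secondMoment (fun y => ‖y‖ₑ) μ < ∞ → secondMoment (fun b : A => ‖(b : M)‖ₑ) l < ∞ →
    |m.f k x μ a l| ≤
      C * (1 + ‖x‖ ^ 2 + ‖(a : M)‖ ^ 2 + (secondMoment (fun y => ‖y‖ₑ) μ).toReal
        + (secondMoment (fun b : A => ‖(b : M)‖ₑ) l).toReal)) ∧
  ∃ C : ℝ, 0 < C ∧ ∀ x μ, secondMoment (fun y => ‖y‖ₑ) μ < ∞ →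
    |m.g x μ| ≤ C * (1 + ‖x‖ ^ 2 + (secondMoment (fun y => ‖y‖ₑ) μ).toReal)

/-- The running cost `f̂_k(μ, α) = ∫ f_k(x, μ, α(x), α ⋆ μ) μ(dx)`. -/
def fhat (k : ℕ) (μ : ProbabilityMeasure E) (α : Policy E A) : ℝ :=
  ∫ x, m.f k x μ (α.1 x) (α.push μ) ∂(μ : Measure E)

/-- The terminal cost `ĝ(μ) = ∫ g(x, μ) μ(dx)`. -/
def ghat (μ : ProbabilityMeasure E) : ℝ := ∫ x, m.g x μ ∂(μ : Measure E)

/-- The transitions under a policy form a measurable family of measures. -/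
theorem measurable_P (k : ℕ) (μ : ProbabilityMeasure E) (α : Policy E A)
    (l : ProbabilityMeasure A) : Measurable (fun x => m.P k x μ (α.1 x) l) := by
  have hF : Measurable (fun p : E × Ω => m.F k p.1 μ (α.1 p.1) l (m.ε k p.2)) :=
    (m.measurable_F k).comp (measurable_fst.prodMk (measurable_const.prodMk
      ((α.2.1.comp measurable_fst).prodMk (measurable_const.prodMk
        ((m.measurable_ε k).comp measurable_snd)))))
  refine Measure.measurable_of_measurable_coe _ fun s hs => ?_
  have h := measurable_measure_prodMk_left (ν := Pr) (hF hs)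
  convert h using 2 with x
  exact Measure.map_apply (hF.comp measurable_prodMk_left) hs

theorem isProbabilityMeasure_P (k : ℕ) (x : E) (μ : ProbabilityMeasure E) (a : A)
    (l : ProbabilityMeasure A) : IsProbabilityMeasure (m.P k x μ a l) :=
  Measure.isProbabilityMeasure_map ((m.measurable_F k).comp
    (measurable_const.prodMk (measurable_const.prodMk (measurable_const.prodMk
      (measurable_const.prodMk (m.measurable_ε k)))))).aemeasurable

/-- The evolution map
`Φ_{k+1}(μ, α)(dx') = ∫ μ(dx) P_{k+1}(x, μ, α(x), α ⋆ μ, dx')`. -/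
def Phi (k : ℕ) (μ : ProbabilityMeasure E) (α : Policy E A) : ProbabilityMeasure E :=
  ⟨(μ : Measure E).bind (fun x => m.P k x μ (α.1 x) (α.push μ)),
    isProbabilityMeasure_bind (m.measurable_P k μ α (α.push μ)).aemeasurable
      (Filter.Eventually.of_forall fun x =>
        m.isProbabilityMeasure_P k x μ (α.1 x) (α.push μ))⟩

/-- Value functions, indexed by the number `j` of remaining time steps. -/
def valueToGo : ℕ → ProbabilityMeasure E → EReal
  | 0, μ => (m.ghat μ : EReal)
  | j + 1, μ => ⨅ α : Policy E A,
      ((m.fhat (n - (j + 1)) μ α : ℝ) : EReal) + valueToGo j (m.Phi (n - (j + 1)) μ α)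

/-- The value functions `v_k`, `k = 0, …, n`, of the measure-valued dynamic programming:
`v_n(μ) = ĝ(μ)` and `v_k(μ) = inf_α [f̂_k(μ, α) + v_{k+1}(Φ_{k+1}(μ, α))]`, as extended reals. -/
def v (k : ℕ) (μ : ProbabilityMeasure E) : EReal := m.valueToGo (n - k) μ

theorem v_last (μ : ProbabilityMeasure E) : m.v n μ = (m.ghat μ : EReal) := by
  simp [v, valueToGo]

theorem v_of_lt {k : ℕ} (hk : k < n) (μ : ProbabilityMeasure E) :
    m.v k μ = ⨅ α : Policy E A, ((m.fhat k μ α : ℝ) : EReal) + m.v (k + 1) (m.Phi k μ α) := by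
  have h1 : n - k = (n - (k + 1)) + 1 := by omega
  have h2 : n - ((n - (k + 1)) + 1) = k := by omega
  rw [v, h1, valueToGo, h2]
  rfl

/-- The state process controlled in feedback form by `α`:
`X_0 = ξ`, `X_{k+1} = F_{k+1}(X_k, law(X_k), α_k(X_k), law(α_k(X_k)), ε_{k+1})`. -/
def X (α : ℕ → Policy E A) : ℕ → {Y : Ω → E // Measurable Y}
  | 0 => ⟨m.ξ, m.measurable_ξ⟩
  | k + 1 =>
    let Y := X α k
    let U : {U : Ω → A // Measurable U} := ⟨fun ω => (α k).1 (Y.1 ω), (α k).2.1.comp Y.2⟩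
    ⟨fun ω => m.F k (Y.1 ω) (law Pr Y) (U.1 ω) (law Pr U) (m.ε k ω),
      (m.measurable_F k).comp (Y.2.prodMk (measurable_const.prodMk (U.2.prodMk
        (measurable_const.prodMk (m.measurable_ε k)))))⟩

/-- The value process
`V_k^α = inf { ∑_{j=k}^{n-1} f̂_j(law(X_j^β), β_j) + ĝ(law(X_n^β)) : β_j = α_j for j < k }`. -/
def V (k : ℕ) (α : ℕ → Policy E A) : EReal :=
  ⨅ β : {β : ℕ → Policy E A // ∀ j < k, β j = α j},
    ((∑ j ∈ Finset.Ico k n, m.fhat j (law Pr (m.X β.1 j)) (β.1 j)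
      + m.ghat (law Pr (m.X β.1 n)) : ℝ) : EReal)

end System

end

end McKeanVlasov

end

/-! Without interaction the problem is an ordinary Markov decision problem, and the claim is that
minimising over feedback policies commutes with integration against `μ`. If `v_{k+1}` is integration
of `W`, Fubini turns the bracket defining `v_k(μ)` into `∫ c(x, α(x)) μ(dx)`, where `c(x, a) =
f_k(x, a) + ∫ W dP_{k+1}(x, a, ·)`. The infimum over `α` is at least `∫ inf_a c(x, a) μ(dx)`.
Equality follows from choosing, for `μ`-almost every `x` and measurably in `x`, a control that is
optimal up to `δ`. Backward induction then gives (i) and (ii).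

The difficulty is measurability, since the infimum over `a` of a Borel function need not be Borel.
The induction runs in the class of lower semianalytic functions, whose strict sublevel sets are
analytic. This class is stable under adding a Borel function, integrating out the noise
(`IsLowerSemianalytic.integral`) and taking the infimum over `a` (`IsLowerSemianalytic.iInf`). Its
members are measurable for every completed finite measure (`IsBorelProjection.nullMeasurableSet`),
and near-optimal controls come from Jankov–von Neumann selection
(`IsBorelProjection.exists_measurable_ae_selection`).

Since `A` is bounded, (H1) and (H2) give quadratic growth uniformly in the control. Growth therefore
passes from `W` to the infimum, all integrals are finite, and every measurable map into `A` is a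
policy. The same bounds control the moments of the state uniformly over controls, whence `V_k^α >
-∞`. -/

section

open Set Filter Topology

/-- A set is a Borel projection if it is the projection of a measurable subset of its product with
Baire space. In a standard Borel space these are the analytic sets. -/
def IsBorelProjection {Z : Type*} [MeasurableSpace Z] (S : Set Z) : Prop :=
  ∃ B : Set (Z × (ℕ → ℕ)), MeasurableSet B ∧ ∀ z, z ∈ S ↔ ∃ y, (z, y) ∈ B

/-! ### Closure properties of analytic sets -/

section BorelProjection

variable {Z Y A : Type*} [MeasurableSpace Z] [MeasurableSpace Y] [MeasurableSpace A]

theorem MeasurableSet.isBorelProjection {S : Set Z} (hS : MeasurableSet S) :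
    IsBorelProjection S :=
  ⟨Prod.fst ⁻¹' S, measurable_fst hS, fun z => by simp⟩

theorem IsBorelProjection.preimage {S : Set Z} (hS : IsBorelProjection S) {h : Y → Z}
    (hh : Measurable h) : IsBorelProjection (h ⁻¹' S) := by
  obtain ⟨B, hB, hS⟩ := hS
  exact ⟨Prod.map h id ⁻¹' B, (hh.prodMap measurable_id) hB, fun z => hS (h z)⟩

/-- Entry `0` of the witness codes the index of a member of the family; the shifted sequence is a
witness for that member. -/
theorem IsBorelProjection.iUnion {ι : Type*} [Countable ι] {S : ι → Set Z}
    (hS : ∀ i, IsBorelProjection (S i)) : IsBorelProjection (⋃ i, S i) := by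
  choose B hB hS using hS
  obtain ⟨e, he⟩ := Countable.exists_injective_nat ι
  refine ⟨⋃ i, {p | p.2 0 = e i} ∩ (fun p => (p.1, fun n => p.2 (n + 1))) ⁻¹' (B i),
    MeasurableSet.iUnion fun i => .inter ?_ ?_, fun z => ?_⟩
  · exact measurableSet_eq_fun (by fun_prop) (by fun_prop)
  · exact (show Measurable fun p : Z × (ℕ → ℕ) => (p.1, fun n => p.2 (n + 1)) by fun_prop) (hB i)
  · simp only [mem_iUnion, hS, mem_inter_iff, mem_ofPred_eq, mem_preimage]
    constructor
    · rintro ⟨i, y, hy⟩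
      exact ⟨fun n => Nat.casesOn n (e i) y, i, rfl, hy⟩
    · rintro ⟨y, i, -, hy⟩
      exact ⟨i, _, hy⟩

/-- The pairing function packs countably many witnesses into a single sequence. -/
theorem IsBorelProjection.iInter {S : ℕ → Set Z}
    (hS : ∀ i, IsBorelProjection (S i)) : IsBorelProjection (⋂ i, S i) := by
  choose B hB hS using hS
  refine ⟨⋂ i, (fun p => (p.1, fun n => p.2 (Nat.pair i n))) ⁻¹' (B i),
    MeasurableSet.iInter fun i => ?_, fun z => ?_⟩
  · exact (show Measurable fun p : Z × (ℕ → ℕ) => (p.1, fun n => p.2 (Nat.pair i n)) by fun_prop)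
      (hB i)
  · simp only [mem_iInter, hS, mem_preimage]
    constructor
    · intro h
      choose y hy using h
      exact ⟨fun n => y n.unpair.1 n.unpair.2, fun i => by simpa using hy i⟩
    · rintro ⟨y, hy⟩ i
      exact ⟨_, hy i⟩

theorem IsBorelProjection.inter {S T : Set Z} (hS : IsBorelProjection S)
    (hT : IsBorelProjection T) : IsBorelProjection (S ∩ T) := by
  have : S ∩ T = ⋂ i : ℕ, if i = 0 then S else T := by
    ext z
    simp only [mem_inter_iff, mem_iInter]
    refine ⟨fun h i => ?_, fun h => ⟨by simpa using h 0, by simpa using h 1⟩⟩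
    split_ifs
    exacts [h.1, h.2]
  rw [this]
  refine .iInter fun i => ?_
  split_ifs
  exacts [hS, hT]

theorem IsBorelProjection.union {S T : Set Z} (hS : IsBorelProjection S)
    (hT : IsBorelProjection T) : IsBorelProjection (S ∪ T) := by
  rw [union_eq_iUnion]
  exact .iUnion fun b => by cases b <;> assumption

theorem exists_measurable_surjection_baire (A : Type*) [MeasurableSpace A] [StandardBorelSpace A]
    [Nonempty A] : ∃ q : (ℕ → ℕ) → A, Measurable q ∧ Function.Surjective q := by
  let := upgradeStandardBorel A
  obtain ⟨q, hq, hs⟩ := PolishSpace.exists_nat_nat_continuous_surjective A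
  exact ⟨q, hq.measurable, hs⟩

/-- Baire space maps measurably onto `A`, so the quantified point is replaced by a sequence. This
sequence and the original witness are interleaved on the even and odd entries. -/
theorem IsBorelProjection.exists_right [StandardBorelSpace A] {S : Set (Z × A)}
    (hS : IsBorelProjection S) : IsBorelProjection {z | ∃ a, (z, a) ∈ S} := by
  rcases isEmpty_or_nonempty A with hA | hA
  · simpa using MeasurableSet.empty.isBorelProjection
  obtain ⟨q, hq, hqs⟩ := exists_measurable_surjection_baire A
  obtain ⟨B, hB, hS⟩ := hS
  refine ⟨(fun p => ((p.1, q fun n => p.2 (2 * n)), fun n => p.2 (2 * n + 1))) ⁻¹' B, ?_,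
    fun z => ?_⟩
  · exact (show Measurable fun p : Z × (ℕ → ℕ) =>
      ((p.1, q fun n => p.2 (2 * n)), fun n => p.2 (2 * n + 1)) by fun_prop) hB
  · simp only [mem_ofPred_eq, hS, mem_preimage]
    constructor
    · rintro ⟨a, y, hy⟩
      obtain ⟨x, rfl⟩ := hqs a
      refine ⟨fun n => if n % 2 = 0 then x (n / 2) else y (n / 2), ?_⟩
      have h1 : (fun n => if 2 * n % 2 = 0 then x (2 * n / 2) else y (2 * n / 2)) = x := by
        ext n; simp
      have h2 : (fun n => if (2 * n + 1) % 2 = 0 then x ((2 * n + 1) / 2)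
          else y ((2 * n + 1) / 2)) = y := by
        ext n
        rw [if_neg (by omega)]
        congr 1
        omega
      simpa only [h1, h2] using hy
    · rintro ⟨y, hy⟩
      exact ⟨_, _, hy⟩

theorem IsBorelProjection.exists_continuous_range [TopologicalSpace Z] [PolishSpace Z]
    [BorelSpace Z] {S : Set Z} (hS : IsBorelProjection S) (hne : S.Nonempty) :
    ∃ f : (ℕ → ℕ) → Z, Continuous f ∧ range f = S := by
  obtain ⟨B, hB, hS⟩ := hS
  have h : AnalyticSet S := by
    have : S = Prod.fst '' B := by
      ext z
      simp [hS]
    rw [this]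
    exact hB.analyticSet_image measurable_fst
  rw [AnalyticSet] at h
  exact h.resolve_left hne.ne_empty

end BorelProjection

/-! ### Approximation from inside, universal measurability, measures of sections -/

section Capacity

/-- The sequences whose first `n` entries are bounded by those of `s`. -/
def boundedPrefix {n : ℕ} (s : Fin n → ℕ) : Set (ℕ → ℕ) := {σ | ∀ i : Fin n, σ i ≤ s i}

/-- The sequences below `b` form a compact set, so a point outside its image is separated from the
image by disjoint open sets. By compactness, some finite prefix of the bounds already forces `f`
into the open set around the image. -/
theorem iInter_closure_image_boundedPrefix {Y : Type*} [TopologicalSpace Y] [T2Space Y]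
    {f : (ℕ → ℕ) → Y} (hf : Continuous f) (b : ℕ → ℕ) :
    ⋂ n : ℕ, closure (f '' boundedPrefix fun i : Fin n => b i) ⊆ f '' {σ | ∀ i, σ i ≤ b i} := by
  intro y hy
  by_contra hyK
  have hK : IsCompact {σ : ℕ → ℕ | ∀ i, σ i ≤ b i} := by
    have := isCompact_univ_pi (fun i => (finite_Iic (b i)).isCompact)
    convert this using 1
    ext σ
    simp [Pi.le_def]
  obtain ⟨W, V, hW, hV, hKW, hyV, hd⟩ := SeparatedNhds.of_isCompact_isCompact
    (hK.image hf) (isCompact_singleton (x := y))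
    (by simpa [disjoint_singleton_right] using hyK)
  have key : ∃ n : ℕ, boundedPrefix (fun i : Fin n => b i) ⊆ f ⁻¹' W := by
    by_contra! hcon
    simp only [not_subset] at hcon
    choose σ hσ hσW using hcon
    -- Truncating at `b` puts the sequences in the compact set and leaves the first `n` entries of
    -- `σ n` unchanged, so the limit is not affected.
    obtain ⟨τ, hτ, φ, hφ, hlim⟩ := hK.tendsto_subseq (x := fun n i => min (σ n i) (b i))
      (fun n i => min_le_right _ _)
    have hlim' : Tendsto (fun n => σ (φ n)) atTop (𝓝 τ) := by
      rw [tendsto_pi_nhds] at hlim ⊢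
      intro i
      refine (hlim i).congr' ?_
      filter_upwards [eventually_gt_atTop i] with n hn
      exact min_eq_left (hσ (φ n) ⟨i, hn.trans_le (hφ.id_le n)⟩)
    have hmem : ∀ᶠ n in atTop, σ (φ n) ∈ f ⁻¹' W :=
      hlim' ((hW.preimage hf).mem_nhds (hKW (mem_image_of_mem f hτ)))
    obtain ⟨n, hn⟩ := hmem.exists
    exact hσW _ hn
  obtain ⟨n, hn⟩ := key
  have h1 : y ∈ closure W := closure_mono (image_subset_iff.2 hn) (mem_iInter.1 hy n)
  exact (hd.symm.closure_right hV).le_bot ⟨hyV rfl, h1⟩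

/-- The bounds are chosen one entry at a time. Relaxing the bound on the next entry exhausts the
current set increasingly, and continuity along increasing unions holds for outer measure, so the
images need not be measurable. -/
theorem exists_bound_of_lt_measure {T Y : Type*} [MeasurableSpace T] (ν : Measure T)
    (g : T → Y) (f : (ℕ → ℕ) → Y) {c : ℝ≥0∞} (hc : c < ν (g ⁻¹' range f)) :
    ∃ b : ℕ → ℕ, ∀ n : ℕ, c < ν (g ⁻¹' (f '' boundedPrefix fun i : Fin n => b i)) := by
  let U : ℕ → (ℕ → ℕ) → Set (ℕ → ℕ) := fun n b => {σ | ∀ i < n, σ i ≤ b i}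
  have step : ∀ n b, c < ν (g ⁻¹' (f '' U n b)) →
      ∃ k, c < ν (g ⁻¹' (f '' U (n + 1) (Function.update b n k))) := by
    intro n b h
    have hU : U n b = ⋃ k, U (n + 1) (Function.update b n k) := by
      ext σ
      simp only [U, mem_ofPred_eq, mem_iUnion]
      constructor
      · refine fun h => ⟨σ n, fun i hi => ?_⟩
        rcases eq_or_ne i n with rfl | hin
        · simp
        · simpa [hin] using h i (by omega)
      · rintro ⟨k, h⟩ i hi
        simpa [hi.ne] using h i (by omega)
    have hm : Monotone fun k => g ⁻¹' (f '' U (n + 1) (Function.update b n k)) := by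
      intro k l hkl
      refine preimage_mono (image_mono fun σ hσ i hi => (hσ i hi).trans ?_)
      rcases eq_or_ne i n with rfl | hin
      · simpa
      · simp [hin]
    rw [hU, image_iUnion, preimage_iUnion, hm.measure_iUnion, lt_iSup_iff] at h
    exact h
  choose! k hk using step
  let b : ℕ → (ℕ → ℕ) := fun n => Nat.rec 0 (fun n b => Function.update b n (k n b)) n
  have hb : ∀ n, b (n + 1) = Function.update (b n) n (k n (b n)) := fun n => rfl
  have hc' : ∀ n, c < ν (g ⁻¹' (f '' U n (b n))) := by
    intro n
    induction n with
    | zero => simpa [U, image_univ] using hc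
    | succ n ih => exact hk n _ ih
  have hstab : ∀ n, ∀ i < n, b n i = b (i + 1) i := by
    intro n
    induction n with
    | zero => intro i hi; omega
    | succ n ih =>
      intro i hi
      rcases eq_or_ne i n with rfl | hin
      · rfl
      · rw [hb, Function.update_of_ne hin, ih i (by omega)]
  -- Entry `i` is fixed at stage `i + 1` and never changed afterwards.
  refine ⟨fun i => b (i + 1) i, fun n => ?_⟩
  convert hc' n using 4
  ext σ
  simp only [boundedPrefix, U, mem_ofPred_eq, Fin.forall_iff]
  exact forall₂_congr fun i hi => by rw [hstab n i hi]

/-- Passing to closures gives measurable sets, so continuity from above applies; by compactness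
their intersection still lies in the preimage of the range. -/
theorem measurableSet_and_le_of_forall_closure {T Y : Type*} [MeasurableSpace T]
    [TopologicalSpace Y] [T2Space Y] [MeasurableSpace Y] [BorelSpace Y]
    (ν : Measure T) [IsFiniteMeasure ν]
    {g : T → Y} (hg : Measurable g) {f : (ℕ → ℕ) → Y} (hf : Continuous f) (b : ℕ → ℕ) {c : ℝ≥0∞}
    (h : ∀ n : ℕ, c ≤ ν (g ⁻¹' closure (f '' boundedPrefix fun i : Fin n => b i))) :
    ∃ D ⊆ g ⁻¹' range f, MeasurableSet D ∧ c ≤ ν D := by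
  have hmeas : ∀ n : ℕ,
      MeasurableSet (g ⁻¹' closure (f '' boundedPrefix fun i : Fin n => b i)) :=
    fun n => hg isClosed_closure.measurableSet
  refine ⟨⋂ n : ℕ, g ⁻¹' closure (f '' boundedPrefix fun i : Fin n => b i), ?_,
    .iInter hmeas, ?_⟩
  · rw [← preimage_iInter]
    exact preimage_mono ((iInter_closure_image_boundedPrefix hf b).trans (image_subset_range _ _))
  · rw [Antitone.measure_iInter]
    · exact le_iInf h
    · refine fun n m hnm => preimage_mono (closure_mono (image_mono fun σ hσ i => ?_))
      exact hσ (Fin.castLE hnm i)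
    · exact fun n => (hmeas n).nullMeasurableSet
    · exact ⟨0, measure_ne_top _ _⟩

variable {Z Y : Type*} [MeasurableSpace Z] [MeasurableSpace Y]

/-- Analytic sets are universally measurable. -/
theorem IsBorelProjection.nullMeasurableSet [StandardBorelSpace Z] {S : Set Z}
    (hS : IsBorelProjection S) (μ : Measure Z) [IsFiniteMeasure μ] : NullMeasurableSet S μ := by
  let := upgradeStandardBorel Z
  rcases S.eq_empty_or_nonempty with rfl | hne
  · exact MeasurableSet.empty.nullMeasurableSet
  obtain ⟨f, hf, rfl⟩ := hS.exists_continuous_range hne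
  -- Measurable subsets have measure arbitrarily close to that of the range; a countable union of
  -- them fills it up to a null set.
  have key : ∀ c < μ (range f), ∃ D ⊆ range f, MeasurableSet D ∧ c ≤ μ D := by
    intro c hc
    obtain ⟨b, hb⟩ := exists_bound_of_lt_measure μ id f hc
    exact measurableSet_and_le_of_forall_closure μ measurable_id hf b
      fun n => (hb n).le.trans (measure_mono (preimage_mono subset_closure))
  rcases eq_or_ne (μ (range f)) 0 with h0 | h0
  · exact NullMeasurableSet.of_null h0
  obtain ⟨u, -, hu, hlim⟩ := exists_seq_strictMono_tendsto' (pos_iff_ne_zero.2 h0)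
  choose D hDS hDm hD using fun n => key (u n) (hu n).2
  have hle : μ (range f) ≤ μ (⋃ n, D n) :=
    le_of_tendsto' hlim fun n => (hD n).trans (measure_mono (subset_iUnion D n))
  have hae : (⋃ n, D n) =ᵐ[μ] range f :=
    ae_eq_of_subset_of_measure_ge (iUnion_subset hDS) hle
      (MeasurableSet.iUnion hDm).nullMeasurableSet (measure_ne_top _ _)
  exact (MeasurableSet.iUnion hDm).nullMeasurableSet.congr hae

/-- Only countably many prefixes exist, so joint measurability reduces to that of section measures
for one fixed set. -/
theorem measurableSet_le_measure_section_prefix {n : ℕ} {C : (Fin n → ℕ) → Set (Z × Y)}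
    (hC : ∀ s, MeasurableSet (C s)) (ν : Measure Y) [SFinite ν] (c : ℝ≥0∞) :
    MeasurableSet {p : Z × (ℕ → ℕ) | c ≤ ν (Prod.mk p.1 ⁻¹' C fun i : Fin n => p.2 i)} := by
  have h1 : Measurable fun p : Z × (Fin n → ℕ) => ν (Prod.mk p.1 ⁻¹' C p.2) :=
    measurable_from_prod_countable_left fun s => measurable_measure_prodMk_left (hC s)
  have h2 : Measurable fun p : Z × (ℕ → ℕ) => (p.1, fun i : Fin n => p.2 i) :=
    measurable_fst.prodMk (measurable_pi_lambda _ fun i =>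
      (measurable_pi_apply (i : ℕ)).comp measurable_snd)
  exact measurableSet_le measurable_const (h1.comp h2)

/-- A section has measure above `c` exactly when some sequence of bounds certifies it through closed
sets, and that sequence serves as the Baire witness. -/
theorem isBorelProjection_lt_measure_section_range [TopologicalSpace Z] [BorelSpace Z]
    [TopologicalSpace Y] [BorelSpace Y] [T2Space (Z × Y)] [BorelSpace (Z × Y)]
    {f : (ℕ → ℕ) → Z × Y} (hf : Continuous f) (ν : Measure Y) [IsFiniteMeasure ν] (c : ℝ≥0∞) :
    IsBorelProjection {z | c < ν (Prod.mk z ⁻¹' range f)} := by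
  -- The decreasing intersection preserves only `≤`; a rational strictly above `c` keeps the
  -- inequality strict.
  have heq : {z | c < ν (Prod.mk z ⁻¹' range f)} =
      ⋃ q : {q : ℚ // c < ENNReal.ofReal q}, {z | ∃ b : ℕ → ℕ, ∀ n : ℕ,
        ENNReal.ofReal (q : ℚ) ≤
          ν (Prod.mk z ⁻¹' closure (f '' boundedPrefix fun i : Fin n => b i))} := by
    ext z
    simp only [mem_ofPred_eq, mem_iUnion, Subtype.exists, exists_prop]
    constructor
    · intro h
      obtain ⟨q, -, hq, hq'⟩ := ENNReal.lt_iff_exists_rat_btwn.1 h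
      obtain ⟨b, hb⟩ := exists_bound_of_lt_measure ν (Prod.mk z) f hq'
      exact ⟨q, hq, b, fun n => (hb n).le.trans (measure_mono (preimage_mono subset_closure))⟩
    · rintro ⟨q, hq, b, hb⟩
      obtain ⟨D, hD, -, hDν⟩ :=
        measurableSet_and_le_of_forall_closure ν measurable_prodMk_left hf b hb
      exact hq.trans_le (hDν.trans (measure_mono hD))
  rw [heq]
  refine .iUnion fun q => ⟨⋂ n : ℕ, {p | ENNReal.ofReal (q : ℚ) ≤
      ν (Prod.mk p.1 ⁻¹' closure (f '' boundedPrefix fun i : Fin n => p.2 i))},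
    .iInter fun n => ?_, fun z => by simp⟩
  exact measurableSet_le_measure_section_prefix
    (C := fun s => closure (f '' boundedPrefix s)) (fun s => isClosed_closure.measurableSet) ν _

theorem IsBorelProjection.lt_measure_section_of_finite [StandardBorelSpace Z]
    [StandardBorelSpace Y] {S : Set (Z × Y)} (hS : IsBorelProjection S) (ν : Measure Y)
    [IsFiniteMeasure ν] (c : ℝ≥0∞) : IsBorelProjection {z | c < ν (Prod.mk z ⁻¹' S)} := by
  let := upgradeStandardBorel Z
  let := upgradeStandardBorel Y
  rcases S.eq_empty_or_nonempty with rfl | hne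
  · simpa using MeasurableSet.empty.isBorelProjection
  obtain ⟨f, hf, rfl⟩ := hS.exists_continuous_range hne
  exact isBorelProjection_lt_measure_section_range hf ν c

theorem IsBorelProjection.lt_measure_section [StandardBorelSpace Z]
    [StandardBorelSpace Y] {S : Set (Z × Y)} (hS : IsBorelProjection S) (ν : Measure Y)
    [SigmaFinite ν] (c : ℝ≥0∞) : IsBorelProjection {z | c < ν (Prod.mk z ⁻¹' S)} := by
  have : {z | c < ν (Prod.mk z ⁻¹' S)} =
      ⋃ i, {z | c < ν.restrict (spanningSets ν i) (Prod.mk z ⁻¹' S)} := by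
    ext z
    rw [mem_ofPred_eq, ← Measure.iSup_restrict_spanningSets, lt_iSup_iff]
    simp
  rw [this]
  refine .iUnion fun i => ?_
  have : IsFiniteMeasure (ν.restrict (spanningSets ν i)) :=
    ⟨by simpa using measure_spanningSets_lt_top ν i⟩
  exact hS.lt_measure_section_of_finite _ c

end Capacity

/-! ### Measurable selection by leftmost branches -/

section Selection

variable {Z A : Type*} [MeasurableSpace Z] [MeasurableSpace A]

/-- The least `k` such that `z` lies in the set of index `k :: s` of the scheme `G`. -/
noncomputable def leftmostDigit (G : List ℕ → Set Z) (s : List ℕ) (z : Z) : ℕ :=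
  sInf {k | z ∈ G (k :: s)}

/-- The first `n` entries, in reverse order, of the leftmost branch of the scheme `G` at `z`. -/
noncomputable def leftmostPrefix (G : List ℕ → Set Z) (z : Z) : ℕ → List ℕ
  | 0 => []
  | n + 1 => leftmostDigit G (leftmostPrefix G z n) z :: leftmostPrefix G z n

theorem nullMeasurableSet_leftmostDigit_eq {G : List ℕ → Set Z} {μ : Measure Z}
    (hG : ∀ s, NullMeasurableSet (G s) μ) (s : List ℕ) (j : ℕ) :
    NullMeasurableSet {z | leftmostDigit G s z = j} μ := by
  -- The second term is the convention `sInf ∅ = 0`: the digit is `0` when no successor contains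
  -- `z`.
  have heq : {z | leftmostDigit G s z = j} = (G (j :: s) ∩ ⋂ k : Fin j, (G (k :: s))ᶜ) ∪
      {z | j = 0} ∩ ⋂ k, (G (k :: s))ᶜ := by
    ext z
    simp only [leftmostDigit, mem_ofPred_eq, mem_union, mem_inter_iff, mem_iInter, mem_compl_iff]
    constructor
    · rintro rfl
      by_cases h : ∃ k, z ∈ G (k :: s)
      · exact .inl ⟨Nat.sInf_mem (s := {k | z ∈ G (k :: s)}) h,
          fun k => Nat.notMem_of_lt_sInf k.2⟩
      · push Not at h
        exact .inr ⟨by simp [h], h⟩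
    · rintro (⟨h1, h2⟩ | ⟨rfl, h⟩)
      · refine le_antisymm (Nat.sInf_le h1) (le_of_not_gt fun hlt => ?_)
        exact h2 ⟨_, hlt⟩ (Nat.sInf_mem (s := {k | z ∈ G (k :: s)}) ⟨j, h1⟩)
      · simp [h]
  rw [heq]
  exact ((hG _).inter (.iInter fun k => (hG _).compl)).union
    ((MeasurableSet.const _).nullMeasurableSet.inter (.iInter fun k => (hG _).compl))

theorem nullMeasurableSet_leftmostPrefix_eq {G : List ℕ → Set Z} {μ : Measure Z}
    (hG : ∀ s, NullMeasurableSet (G s) μ) (n : ℕ) (s : List ℕ) :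
    NullMeasurableSet {z | leftmostPrefix G z n = s} μ := by
  induction n generalizing s with
  | zero => exact (MeasurableSet.const ([] = s)).nullMeasurableSet
  | succ n ih =>
    cases s with
    | nil => simp [leftmostPrefix]
    | cons k t =>
      have : {z | leftmostPrefix G z (n + 1) = k :: t} =
          {z | leftmostDigit G t z = k} ∩ {z | leftmostPrefix G z n = t} := by
        ext z
        simp only [leftmostPrefix, List.cons.injEq, mem_ofPred_eq, mem_inter_iff]
        refine and_congr_left fun h => by rw [h]
      rw [this]
      exact (nullMeasurableSet_leftmostDigit_eq hG t k).inter (ih t)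

theorem aemeasurable_leftmostBranch {G : List ℕ → Set Z} {μ : Measure Z}
    (hG : ∀ s, NullMeasurableSet (G s) μ) :
    AEMeasurable (fun z n => leftmostDigit G (leftmostPrefix G z n) z) μ := by
  refine aemeasurable_pi_iff.2 fun n => ?_
  refine NullMeasurable.aemeasurable ?_
  refine measurable_to_countable' (β := NullMeasurableSpace Z μ) fun j => ?_
  have : (fun z => leftmostDigit G (leftmostPrefix G z n) z) ⁻¹' {j} =
      ⋃ t, {z | leftmostPrefix G z n = t} ∩ {z | leftmostDigit G t z = j} := by
    ext z
    simp
  refine (congrArg (NullMeasurableSet · μ) this).mpr ?_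
  exact NullMeasurableSet.iUnion fun t => (nullMeasurableSet_leftmostPrefix_eq hG n t).inter
    (nullMeasurableSet_leftmostDigit_eq hG t j)

theorem measurableSet_res_eq (s : List ℕ) (n : ℕ) :
    MeasurableSet {τ : ℕ → ℕ | PiNat.res τ n = s} := by
  rcases Set.eq_empty_or_nonempty {τ : ℕ → ℕ | PiNat.res τ n = s} with h | ⟨x, rfl⟩
  · rw [h]
    exact .empty
  · have h : IsOpen {τ : ℕ → ℕ | PiNat.res τ n = PiNat.res x n} := by
      rw [← PiNat.cylinder_eq_res]
      exact PiNat.isOpen_cylinder _ _ _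
    exact h.measurableSet

/-- A continuous map from Baire space has, for every finite measure, a section on its range that is
measurable for the completed measure. -/
theorem exists_aemeasurable_section [TopologicalSpace Z] [PolishSpace Z] [BorelSpace Z]
    {f : (ℕ → ℕ) → Z} (hf : Continuous f) (μ : Measure Z) [IsFiniteMeasure μ] :
    ∃ σ : Z → ℕ → ℕ, AEMeasurable σ μ ∧ ∀ z ∈ range f, f (σ z) = z := by
  -- Images of cylinders are analytic, hence null measurable, and so the leftmost branch is almost
  -- everywhere measurable.
  let G : List ℕ → Set Z := fun s => f '' {τ | PiNat.res τ s.length = s}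
  have hG : ∀ s, NullMeasurableSet (G s) μ := fun s => by
    refine IsBorelProjection.nullMeasurableSet ⟨{p | f p.2 = p.1} ∩
      Prod.snd ⁻¹' {τ | PiNat.res τ s.length = s}, .inter ?_ ?_, fun z => ?_⟩ μ
    · exact measurableSet_eq_fun (hf.measurable.comp measurable_snd) measurable_fst
    · exact measurable_snd (measurableSet_res_eq s _)
    · simp [G, and_comm]
  refine ⟨_, aemeasurable_leftmostBranch hG, ?_⟩
  intro z hz
  set σ : ℕ → ℕ := fun n => leftmostDigit G (leftmostPrefix G z n) z with hσ
  have hres : ∀ n, leftmostPrefix G z n = PiNat.res σ n := by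
    intro n
    induction n with
    | zero => rfl
    | succ n ih => rw [PiNat.res_succ, ← ih]; rfl
  -- The next entry of a preimage of `z` in the current cylinder is an admissible digit, so the
  -- least admissible digit is attained.
  have hmem : ∀ n, z ∈ G (PiNat.res σ n) := by
    intro n
    induction n with
    | zero =>
      obtain ⟨τ, rfl⟩ := hz
      exact ⟨τ, rfl, rfl⟩
    | succ n ih =>
      obtain ⟨τ, hτ, rfl⟩ := ih
      have hτ' : PiNat.res τ n = PiNat.res σ n := by simpa using hτ
      have hne : {k | f τ ∈ G (k :: PiNat.res σ n)}.Nonempty :=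
        ⟨τ n, τ, by simp [PiNat.res_succ, hτ'], rfl⟩
      have := Nat.sInf_mem hne
      rw [PiNat.res_succ]
      have h2 : σ n = sInf {k | f τ ∈ G (k :: PiNat.res σ n)} := by
        rw [← hres n]
        rfl
      rw [h2]
      exact this
  choose τ hτ hτz using hmem
  -- The preimage `τ n` of `z` agrees with `σ` on the first `n` entries, so continuity gives `f σ =
  -- z`.
  have hlim : Tendsto τ atTop (𝓝 σ) := by
    rw [tendsto_pi_nhds]
    intro i
    refine tendsto_const_nhds.congr' ?_
    filter_upwards [eventually_gt_atTop i] with n hn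
    have h : PiNat.res (τ n) n = PiNat.res σ n := by simpa using hτ n
    exact (PiNat.res_eq_res.1 h hn).symm
  have h1 := (hf.tendsto σ).comp hlim
  have h2 : f ∘ τ = fun _ => z := funext hτz
  rw [h2] at h1
  exact tendsto_nhds_unique h1 tendsto_const_nhds

/-- A section of the first coordinate of `f`, followed by the second coordinate, is a selector. A
measurable version of it agrees almost everywhere. -/
theorem exists_measurable_ae_section_range [TopologicalSpace Z] [PolishSpace Z] [BorelSpace Z]
    [TopologicalSpace A] [BorelSpace A]
    {f : (ℕ → ℕ) → Z × A} (hf : Continuous f) (μ : Measure Z) [IsFiniteMeasure μ]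
    [MeasurableSpace.CountablyGenerated A] :
    ∃ α : Z → A, Measurable α ∧ ∀ᵐ z ∂μ, (∃ a, (z, a) ∈ range f) → (z, α z) ∈ range f := by
  obtain ⟨σ, hσ, hfσ⟩ := exists_aemeasurable_section (continuous_fst.comp hf) μ
  have hα : AEMeasurable (fun z => (f (σ z)).2) μ :=
    (continuous_snd.comp hf).measurable.comp_aemeasurable hσ
  refine ⟨hα.mk, hα.measurable_mk, ?_⟩
  filter_upwards [hα.ae_eq_mk] with z hz
  rintro ⟨a, τ, hτ⟩
  rw [← hz]
  exact ⟨σ z, Prod.ext (hfσ z ⟨τ, by simp [hτ]⟩) rfl⟩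

/-- **Jankov–von Neumann selection**, almost everywhere for a given finite measure. -/
theorem IsBorelProjection.exists_measurable_ae_selection [StandardBorelSpace Z]
    [StandardBorelSpace A] [Nonempty A] {S : Set (Z × A)} (hS : IsBorelProjection S)
    (μ : Measure Z) [IsFiniteMeasure μ] :
    ∃ α : Z → A, Measurable α ∧ ∀ᵐ z ∂μ, (∃ a, (z, a) ∈ S) → (z, α z) ∈ S := by
  let := upgradeStandardBorel Z
  let := upgradeStandardBorel A
  rcases S.eq_empty_or_nonempty with rfl | hne
  · exact ⟨fun _ => Classical.arbitrary A, measurable_const, by simp⟩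
  obtain ⟨f, hf, rfl⟩ := hS.exists_continuous_range hne
  exact exists_measurable_ae_section_range hf μ

end Selection

/-! ### Calculus of lower semianalytic functions -/

section LowerSemianalytic

variable {Z Y A : Type*} [MeasurableSpace Z] [MeasurableSpace Y] [MeasurableSpace A]

/-- A real function is lower semianalytic if its strict sublevel sets are analytic. -/
def IsLowerSemianalytic (h : Z → ℝ) : Prop := ∀ c, IsBorelProjection {z | h z < c}

theorem Measurable.isLowerSemianalytic {h : Z → ℝ} (hh : Measurable h) : IsLowerSemianalytic h :=
  fun _ => (measurableSet_lt hh measurable_const).isBorelProjection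

namespace IsLowerSemianalytic

theorem comp {h : Z → ℝ} (hh : IsLowerSemianalytic h) {q : Y → Z} (hq : Measurable q) :
    IsLowerSemianalytic fun y => h (q y) :=
  fun c => (hh c).preimage hq

theorem lt_measurable {h b : Z → ℝ} (hh : IsLowerSemianalytic h) (hb : Measurable b) :
    IsBorelProjection {z | h z < b z} := by
  have : {z | h z < b z} = ⋃ q : ℚ, {z | h z < q} ∩ {z | (q : ℝ) < b z} := by
    ext z
    simp only [mem_ofPred_eq, mem_iUnion, mem_inter_iff]
    exact ⟨exists_rat_btwn, fun ⟨q, h1, h2⟩ => h1.trans h2⟩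
  rw [this]
  exact .iUnion fun q => (hh q).inter (measurableSet_lt measurable_const hb).isBorelProjection

theorem measurable_add {h b : Z → ℝ} (hb : Measurable b) (hh : IsLowerSemianalytic h) :
    IsLowerSemianalytic fun z => b z + h z := fun c => by
  simpa only [lt_sub_iff_add_lt'] using hh.lt_measurable (hb.const_sub c)

theorem iInf [StandardBorelSpace A] [Nonempty A] {h : Z × A → ℝ} (hh : IsLowerSemianalytic h)
    (hbdd : ∀ z, BddBelow (range fun a => h (z, a))) :
    IsLowerSemianalytic fun z => ⨅ a, h (z, a) := fun c => by
  have : {z | ⨅ a, h (z, a) < c} = {z | ∃ a, (z, a) ∈ {p | h p < c}} := by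
    ext z
    exact ciInf_lt_iff (hbdd z)
  rw [this]
  exact (hh c).exists_right

theorem aemeasurable [StandardBorelSpace Z] {h : Z → ℝ} (hh : IsLowerSemianalytic h)
    (μ : Measure Z) [IsFiniteMeasure μ] : AEMeasurable h μ :=
  NullMeasurable.aemeasurable <| measurable_of_Iio (δ := NullMeasurableSpace Z μ)
    fun c => (hh c).nullMeasurableSet μ

/-- The region between the graphs of `h` and `b` has analytic sections in `Y × ℝ`, of area `∫ b - ∫
h`. The integral of `h` is small when this area is large, and the latter is an analytic condition on
`z`. -/
theorem integral [StandardBorelSpace Z] [StandardBorelSpace Y] {h b : Z × Y → ℝ}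
    (hh : IsLowerSemianalytic h) (hb : Measurable b) (hhb : ∀ p, |h p| ≤ b p) (ν : Measure Y)
    [IsFiniteMeasure ν] (hbν : ∀ z, Integrable (fun y => b (z, y)) ν) :
    IsLowerSemianalytic fun z => ∫ y, h (z, y) ∂ν := fun c => by
  have hhν : ∀ z, Integrable (fun y => h (z, y)) ν := fun z =>
    (hbν z).mono' ((hh.comp measurable_prodMk_left).aemeasurable ν).aestronglyMeasurable
      (.of_forall fun y => hhb (z, y))
  let B : Z → ℝ := fun z => ∫ y, b (z, y) ∂ν
  have hB : Measurable B :=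
    (StronglyMeasurable.integral_prod_right (f := fun z y => b (z, y))
      hb.stronglyMeasurable).measurable
  let S : Set (Z × (Y × ℝ)) := {p | h (p.1, p.2.1) < p.2.2} ∩ {p | p.2.2 < b (p.1, p.2.1)}
  have hS : IsBorelProjection S :=
    ((hh.comp (q := fun p : Z × (Y × ℝ) => (p.1, p.2.1)) (by fun_prop)).lt_measurable
      (by fun_prop)).inter (measurableSet_lt (by fun_prop)
        (hb.comp (g := b) (f := fun p : Z × (Y × ℝ) => (p.1, p.2.1))
          (by fun_prop))).isBorelProjection
  have hSν : ∀ z, (ν.prod volume) (Prod.mk z ⁻¹' S) =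
      ENNReal.ofReal (B z - ∫ y, h (z, y) ∂ν) := fun z => by
    have := volume_regionBetween_eq_integral (s := univ) (hhν z).integrableOn (hbν z).integrableOn
      .univ (fun y _ => (le_abs_self _).trans (hhb (z, y)))
    simp only [Measure.restrict_univ, Pi.sub_apply] at this
    rw [integral_sub (hbν z) (hhν z)] at this
    rw [← this]
    congr 1
    ext p
    simp [S, regionBetween]
  -- The rational `q` separates the area from the threshold `B z - c`, which varies with `z`. It
  -- must be nonnegative for `ENNReal.ofReal` to be faithful, so `B z < c` is treated apart.
  have heq : {z | ∫ y, h (z, y) ∂ν < c} = {z | B z < c} ∪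
      ⋃ q : {q : ℚ // 0 ≤ q}, {z | B z - c < (q : ℚ)} ∩
        {z | ENNReal.ofReal (q : ℚ) < (ν.prod volume) (Prod.mk z ⁻¹' S)} := by
    ext z
    have hle : ∫ y, h (z, y) ∂ν ≤ B z :=
      integral_mono (hhν z) (hbν z) fun y => (le_abs_self _).trans (hhb (z, y))
    simp only [mem_ofPred_eq, mem_union, mem_iUnion, mem_inter_iff, hSν, Subtype.exists,
      exists_prop]
    constructor
    · intro hlt
      rcases lt_or_ge (B z) c with hc | hc
      · exact .inl hc
      · obtain ⟨q, hq1, hq2⟩ := exists_rat_btwn (show B z - c < B z - ∫ y, h (z, y) ∂ν by linarith)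
        have hq0 : (0 : ℝ) ≤ q := by linarith
        exact .inr ⟨q, by exact_mod_cast hq0, hq1, (ENNReal.ofReal_lt_ofReal_iff
          (hq0.trans_lt hq2)).2 hq2⟩
    · rintro (hc | ⟨q, hq0, hq1, hq2⟩)
      · linarith
      · have := (ENNReal.ofReal_lt_ofReal_iff_of_nonneg (by exact_mod_cast hq0)).1 hq2
        linarith
  rw [heq]
  refine .union (measurableSet_lt hB measurable_const).isBorelProjection (.iUnion fun q => ?_)
  exact (measurableSet_lt (hB.sub measurable_const) measurable_const).isBorelProjection.inter
    (hS.lt_measure_section _ _)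

end IsLowerSemianalytic

end LowerSemianalytic

/-! ### One step of the Markov decision problem -/

/-- Quadratic growth of a real function on a normed space. -/
def HasQuadraticGrowth {E : Type*} [NormedAddCommGroup E] (W : E → ℝ) : Prop :=
  ∃ K : ℝ, 0 ≤ K ∧ ∀ x, |W x| ≤ K * (1 + ‖x‖ ^ 2)

/-- One step of a Markov decision problem, in which `F` is the transition, driven by a noise of law
`ρ`, and `f` the cost, both of quadratic growth uniformly in the control. -/
structure IsQuadraticStep {E A Y : Type*} [NormedAddCommGroup E] [MeasurableSpace E]
    [MeasurableSpace A] [MeasurableSpace Y] (F : E → A → Y → E) (f : E → A → ℝ)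
    (ρ : Measure Y) : Prop where
  measurable_F : Measurable fun p : (E × A) × Y => F p.1.1 p.1.2 p.2
  measurable_f : Measurable fun p : E × A => f p.1 p.2
  integrable_sq : ∀ x a, Integrable (fun e => ‖F x a e‖ ^ 2) ρ
  exists_integral_sq_le : ∃ C : ℝ, 0 ≤ C ∧ ∀ x a, ∫ e, ‖F x a e‖ ^ 2 ∂ρ ≤ C * (1 + ‖x‖ ^ 2)
  exists_abs_le : ∃ C : ℝ, 0 ≤ C ∧ ∀ x a, |f x a| ≤ C * (1 + ‖x‖ ^ 2)

/-- The cost of the control `a` at `x` when the cost of the next state is `W`. -/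
noncomputable def stepCost {E A Y : Type*} [MeasurableSpace Y] (F : E → A → Y → E) (f : E → A → ℝ)
    (ρ : Measure Y) (W : E → ℝ) (x : E) (a : A) : ℝ :=
  f x a + ∫ e, W (F x a e) ∂ρ

theorem coe_ciInf_of_bddBelow {ι : Type*} [Nonempty ι] {u : ι → ℝ} (hu : BddBelow (range u)) :
    ((⨅ i, u i : ℝ) : EReal) = ⨅ i, (u i : EReal) := by
  refine le_antisymm (le_iInf fun i => EReal.coe_le_coe (ciInf_le hu i)) ?_
  refine EReal.le_of_forall_lt_iff_le.1 fun c hc => ?_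
  obtain ⟨i, hi⟩ := exists_lt_of_ciInf_lt (EReal.coe_lt_coe_iff.1 hc)
  exact iInf_le_of_le i (EReal.coe_le_coe hi.le)

section Growth

variable {E : Type*} [NormedAddCommGroup E] [MeasurableSpace E]

theorem HasQuadraticGrowth.integrable {W : E → ℝ} (hW : HasQuadraticGrowth W) {μ : Measure E}
    [IsFiniteMeasure μ] (hWμ : AEMeasurable W μ) (hμ : Integrable (fun x => ‖x‖ ^ 2) μ) :
    Integrable W μ := by
  obtain ⟨K, -, hK⟩ := hW
  exact (((integrable_const 1).add hμ).const_mul K).mono' hWμ.aestronglyMeasurable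
    (.of_forall hK)

theorem abs_integral_le_of_abs_le_quadratic {W : E → ℝ} {K : ℝ}
    (hK : ∀ x, |W x| ≤ K * (1 + ‖x‖ ^ 2)) {μ : Measure E} [IsProbabilityMeasure μ] (hμ : Integrable (fun x => ‖x‖ ^ 2) μ) :
    |∫ x, W x ∂μ| ≤ K * (1 + ∫ x, ‖x‖ ^ 2 ∂μ) := by
  refine (norm_integral_le_of_norm_le (f := W) (((integrable_const 1).add hμ).const_mul K)
    (.of_forall hK)).trans_eq ?_
  rw [integral_const_mul]
  simp only [Pi.add_apply]
  rw [integral_add (integrable_const _) hμ]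
  simp

theorem integrable_norm_sq_of_lintegral_le {T : Type*} [MeasurableSpace T] {ν : Measure T}
    [OpensMeasurableSpace E] {u : T → E} (hu : AEMeasurable u ν) {K : ℝ≥0∞} (hK : K ≠ ∞)
    (h : ∫⁻ t, ‖u t‖ₑ ^ 2 ∂ν ≤ K) :
    Integrable (fun t => ‖u t‖ ^ 2) ν ∧ ∫ t, ‖u t‖ ^ 2 ∂ν ≤ K.toReal := by
  have heq : ∀ t, ENNReal.ofReal (‖u t‖ ^ 2) = ‖u t‖ₑ ^ 2 := fun t => by
    rw [ENNReal.ofReal_pow (norm_nonneg _), ofReal_norm]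
  have hm : AEStronglyMeasurable (fun t => ‖u t‖ ^ 2) ν :=
    (hu.norm.pow_const 2).aestronglyMeasurable
  constructor
  · refine ⟨hm, ?_⟩
    rw [hasFiniteIntegral_iff_ofReal (.of_forall fun t => by positivity)]
    simp only [heq]
    exact h.trans_lt hK.lt_top
  · rw [integral_eq_lintegral_of_nonneg_ae (.of_forall fun t => by positivity) hm]
    simp only [heq]
    exact ENNReal.toReal_mono hK h

end Growth

namespace IsQuadraticStep

variable {E A Y : Type*} [NormedAddCommGroup E] [MeasurableSpace E]
  [MeasurableSpace A] [MeasurableSpace Y] {F : E → A → Y → E} {f : E → A → ℝ} {ρ : Measure Y}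
  {W : E → ℝ}

theorem measurable_policy (h : IsQuadraticStep F f ρ) {α : E → A} (hα : Measurable α) :
    Measurable fun p : E × Y => F p.1 (α p.1) p.2 :=
  h.measurable_F.comp (f := fun p : E × Y => ((p.1, α p.1), p.2)) (by fun_prop)

theorem measurable_section (h : IsQuadraticStep F f ρ) (x : E) (a : A) : Measurable (F x a) :=
  h.measurable_F.comp (measurable_prodMk_left (x := (x, a)))

theorem integrable_cost (h : IsQuadraticStep F f ρ) {α : E → A} (hα : Measurable α)
    {μ : Measure E} [IsProbabilityMeasure μ] (hμ : Integrable (fun x => ‖x‖ ^ 2) μ) :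
    Integrable (fun x => f x (α x)) μ := by
  obtain ⟨D, hD0, hD⟩ := h.exists_abs_le
  exact HasQuadraticGrowth.integrable ⟨D, hD0, fun x => hD x (α x)⟩
    (h.measurable_f.comp (measurable_id.prodMk hα)).aemeasurable hμ

variable [IsProbabilityMeasure ρ]

theorem integrable_comp [StandardBorelSpace E] [StandardBorelSpace Y]
    (h : IsQuadraticStep F f ρ) (hW : IsLowerSemianalytic W)
    (hWb : HasQuadraticGrowth W) (x : E) (a : A) : Integrable (fun e => W (F x a e)) ρ := by
  obtain ⟨K, -, hK⟩ := hWb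
  exact (((integrable_const 1).add (h.integrable_sq x a)).const_mul K).mono'
    ((hW.comp (h.measurable_section x a)).aemeasurable ρ).aestronglyMeasurable
    (.of_forall fun e => hK _)

theorem exists_abs_stepCost_le (h : IsQuadraticStep F f ρ) (hWb : HasQuadraticGrowth W) :
    ∃ K : ℝ, 0 ≤ K ∧ ∀ x a, |stepCost F f ρ W x a| ≤ K * (1 + ‖x‖ ^ 2) := by
  obtain ⟨K, hK0, hK⟩ := hWb
  obtain ⟨C, hC0, hC⟩ := h.exists_integral_sq_le
  obtain ⟨D, hD0, hD⟩ := h.exists_abs_le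
  refine ⟨D + K * (1 + C), by positivity, fun x a => ?_⟩
  have h1 : |∫ e, W (F x a e) ∂ρ| ≤ K * (1 + ∫ e, ‖F x a e‖ ^ 2 ∂ρ) := by
    refine (norm_integral_le_of_norm_le (f := fun e => W (F x a e))
      (((integrable_const 1).add (h.integrable_sq x a)).const_mul K)
      (.of_forall fun e => hK _)).trans_eq ?_
    rw [integral_const_mul]
    simp only [Pi.add_apply]
    rw [integral_add (integrable_const _) (h.integrable_sq x a)]
    simp
  have h2 : K * (1 + ∫ e, ‖F x a e‖ ^ 2 ∂ρ) ≤ K * (1 + C * (1 + ‖x‖ ^ 2)) := by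
    gcongr
    exact hC x a
  -- This is the exact slack lost when `K` is bounded by `K * (1 + ‖x‖ ^ 2)`.
  have h3 : 0 ≤ K * ‖x‖ ^ 2 := by positivity
  calc |stepCost F f ρ W x a| ≤ |f x a| + |∫ e, W (F x a e) ∂ρ| := abs_add_le _ _
    _ ≤ D * (1 + ‖x‖ ^ 2) + K * (1 + C * (1 + ‖x‖ ^ 2)) :=
      add_le_add (hD x a) (h1.trans h2)
    _ ≤ _ := by linarith

theorem isLowerSemianalytic_stepCost [OpensMeasurableSpace E] [StandardBorelSpace E]
    [StandardBorelSpace A] [StandardBorelSpace Y] (h : IsQuadraticStep F f ρ)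
    (hW : IsLowerSemianalytic W) (hWb : HasQuadraticGrowth W) :
    IsLowerSemianalytic fun p : E × A => stepCost F f ρ W p.1 p.2 := by
  obtain ⟨K, -, hK⟩ := hWb
  refine .measurable_add h.measurable_f ?_
  refine (hW.comp h.measurable_F).integral (b := fun p => K * (1 + ‖F p.1.1 p.1.2 p.2‖ ^ 2))
    ?_ (fun p => hK _) ρ fun z => ?_
  · exact ((h.measurable_F.norm.pow_const 2).const_add 1).const_mul K
  · exact ((integrable_const 1).add (h.integrable_sq z.1 z.2)).const_mul K

theorem bddBelow_stepCost (h : IsQuadraticStep F f ρ) (hWb : HasQuadraticGrowth W) (x : E) :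
    BddBelow (range fun a => stepCost F f ρ W x a) := by
  obtain ⟨K, -, hK⟩ := h.exists_abs_stepCost_le hWb
  exact ⟨-(K * (1 + ‖x‖ ^ 2)), forall_mem_range.2 fun a => (abs_le.1 (hK x a)).1⟩

theorem isLowerSemianalytic_iInf [OpensMeasurableSpace E] [StandardBorelSpace E]
    [StandardBorelSpace A] [Nonempty A] [StandardBorelSpace Y] (h : IsQuadraticStep F f ρ)
    (hW : IsLowerSemianalytic W) (hWb : HasQuadraticGrowth W) :
    IsLowerSemianalytic fun x => ⨅ a, stepCost F f ρ W x a :=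
  (h.isLowerSemianalytic_stepCost hW hWb).iInf fun x => h.bddBelow_stepCost hWb x

theorem hasQuadraticGrowth_iInf [Nonempty A] (h : IsQuadraticStep F f ρ)
    (hWb : HasQuadraticGrowth W) : HasQuadraticGrowth fun x => ⨅ a, stepCost F f ρ W x a := by
  obtain ⟨K, hK0, hK⟩ := h.exists_abs_stepCost_le hWb
  refine ⟨K, hK0, fun x => abs_le.2 ⟨le_ciInf fun a => (abs_le.1 (hK x a)).1, ?_⟩⟩
  exact (ciInf_le (h.bddBelow_stepCost hWb x) (Classical.arbitrary A)).trans
    (abs_le.1 (hK x _)).2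

theorem coe_iInf_stepCost [Nonempty A] (h : IsQuadraticStep F f ρ)
    (hWb : HasQuadraticGrowth W) (x : E) :
    ((⨅ a, stepCost F f ρ W x a : ℝ) : EReal) = ⨅ a, (stepCost F f ρ W x a : EReal) :=
  coe_ciInf_of_bddBelow (h.bddBelow_stepCost hWb x)

/-- The law of the next state is square integrable if that of the current one is. -/
theorem map_integrable_sq [OpensMeasurableSpace E] (h : IsQuadraticStep F f ρ) {α : E → A}
    (hα : Measurable α)
    {μ : Measure E} [IsProbabilityMeasure μ] (hμ : Integrable (fun x => ‖x‖ ^ 2) μ) :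
    Integrable (fun x => ‖x‖ ^ 2) ((μ.prod ρ).map fun p => F p.1 (α p.1) p.2) := by
  have hF := h.measurable_policy hα
  have hsq : Measurable fun x : E => ‖x‖ ^ 2 := by fun_prop
  obtain ⟨C, -, hC⟩ := h.exists_integral_sq_le
  rw [integrable_map_measure hsq.aestronglyMeasurable hF.aemeasurable,
    integrable_prod_iff (hsq.comp hF).aestronglyMeasurable]
  refine ⟨.of_forall fun x => h.integrable_sq x (α x), ?_⟩
  refine (((integrable_const 1).add hμ).const_mul C).mono' ?_ (.of_forall fun x => ?_)
  · exact (StronglyMeasurable.integral_prod_right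
      (f := fun x e => ‖‖F x (α x) e‖ ^ 2‖)
      (hsq.comp hF).norm.stronglyMeasurable).aestronglyMeasurable
  · simp only [Function.comp, norm_pow, norm_norm]
    rw [Real.norm_of_nonneg (integral_nonneg fun e => by positivity)]
    exact hC x (α x)

/-- `W` need not be Borel, but it is almost everywhere measurable for the law of the next state,
which suffices for the change of variables and Fubini. -/
theorem integral_map_eq [StandardBorelSpace E] [OpensMeasurableSpace E]
    (h : IsQuadraticStep F f ρ) (hW : IsLowerSemianalytic W)
    (hWb : HasQuadraticGrowth W) {α : E → A} (hα : Measurable α)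
    {μ : Measure E} [IsProbabilityMeasure μ] (hμ : Integrable (fun x => ‖x‖ ^ 2) μ) :
    Integrable (fun x => ∫ e, W (F x (α x) e) ∂ρ) μ ∧
    ∫ y, W y ∂((μ.prod ρ).map fun p => F p.1 (α p.1) p.2) =
      ∫ x, ∫ e, W (F x (α x) e) ∂ρ ∂μ := by
  have hF := h.measurable_policy hα
  have hWm := hW.aemeasurable ((μ.prod ρ).map fun p => F p.1 (α p.1) p.2)
  have hi := hWb.integrable hWm (h.map_integrable_sq hα hμ)
  have hi' : Integrable (fun p : E × Y => W (F p.1 (α p.1) p.2)) (μ.prod ρ) :=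
    (integrable_map_measure hWm.aestronglyMeasurable hF.aemeasurable).1 hi
  exact ⟨hi'.integral_prod_left, by
    rw [integral_map hF.aemeasurable hWm.aestronglyMeasurable, integral_prod _ hi']⟩

theorem integral_sq_map_le [StandardBorelSpace E] [OpensMeasurableSpace E]
    (h : IsQuadraticStep F f ρ) {C : ℝ}
    (hC : ∀ x a, ∫ e, ‖F x a e‖ ^ 2 ∂ρ ≤ C * (1 + ‖x‖ ^ 2)) {α : E → A} (hα : Measurable α)
    {μ : Measure E} [IsProbabilityMeasure μ] (hμ : Integrable (fun x => ‖x‖ ^ 2) μ) :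
    ∫ y, ‖y‖ ^ 2 ∂((μ.prod ρ).map fun p => F p.1 (α p.1) p.2) ≤
      C * (1 + ∫ x, ‖x‖ ^ 2 ∂μ) := by
  have hsq : Measurable fun x : E => ‖x‖ ^ 2 := by fun_prop
  obtain ⟨hi, heq⟩ := h.integral_map_eq hsq.isLowerSemianalytic
    ⟨1, one_pos.le, fun x => by rw [abs_of_nonneg (by positivity)]; linarith⟩ hα hμ
  rw [heq]
  refine (integral_mono hi (((integrable_const 1).add hμ).const_mul C)
    fun x => hC x (α x)).trans_eq ?_
  rw [integral_const_mul]
  simp only [Pi.add_apply]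
  rw [integral_add (integrable_const _) hμ]
  simp

theorem integral_stepCost [StandardBorelSpace E] [OpensMeasurableSpace E]
    (h : IsQuadraticStep F f ρ) (hW : IsLowerSemianalytic W)
    (hWb : HasQuadraticGrowth W) {α : E → A} (hα : Measurable α)
    {μ : Measure E} [IsProbabilityMeasure μ] (hμ : Integrable (fun x => ‖x‖ ^ 2) μ) :
    Integrable (fun x => stepCost F f ρ W x (α x)) μ ∧
    ∫ x, stepCost F f ρ W x (α x) ∂μ =
      ∫ x, f x (α x) ∂μ + ∫ y, W y ∂((μ.prod ρ).map fun p => F p.1 (α p.1) p.2) := by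
  obtain ⟨hi, heq⟩ := h.integral_map_eq hW hWb hα hμ
  rw [heq]
  exact ⟨(h.integrable_cost hα hμ).add hi, integral_add (h.integrable_cost hα hμ) hi⟩

/-- The integral of the pointwise optimal cost is the infimum over measurable policies. -/
theorem coe_integral_iInf_stepCost [OpensMeasurableSpace E] [StandardBorelSpace E]
    [StandardBorelSpace A] [Nonempty A] [StandardBorelSpace Y] (h : IsQuadraticStep F f ρ)
    (hW : IsLowerSemianalytic W) (hWb : HasQuadraticGrowth W)
    {μ : Measure E} [IsProbabilityMeasure μ] (hμ : Integrable (fun x => ‖x‖ ^ 2) μ) :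
    ((∫ x, ⨅ a, stepCost F f ρ W x a ∂μ : ℝ) : EReal) =
      ⨅ α : {α : E → A // Measurable α}, ((∫ x, stepCost F f ρ W x (α.1 x) ∂μ : ℝ) : EReal) := by
  have hV := h.isLowerSemianalytic_iInf hW hWb
  have hVi := (h.hasQuadraticGrowth_iInf hWb).integrable (hV.aemeasurable μ) hμ
  refine le_antisymm (le_iInf fun α => ?_) ?_
  · exact EReal.coe_le_coe (integral_mono hVi (h.integral_stepCost hW hWb α.2 hμ).1
      fun x => ciInf_le (h.bddBelow_stepCost hWb x) (α.1 x))
  refine EReal.le_of_forall_lt_iff_le.1 fun c hc => ?_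
  obtain ⟨δ, hδ⟩ : ∃ δ, δ = c - ∫ x, ⨅ a, stepCost F f ρ W x a ∂μ := ⟨_, rfl⟩
  have hδ0 : 0 < δ := by
    have := EReal.coe_lt_coe_iff.1 hc
    linarith
  -- A Borel version of the infimum is needed: comparing a lower semianalytic cost with a Borel
  -- threshold gives an analytic set, from which a `δ`-optimal control can be selected.
  let v : E → ℝ := (hV.aemeasurable μ).mk
  have hv : Measurable v := (hV.aemeasurable μ).measurable_mk
  have hvae := (hV.aemeasurable μ).ae_eq_mk
  have hS : IsBorelProjection {p : E × A | stepCost F f ρ W p.1 p.2 < v p.1 + δ} :=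
    (h.isLowerSemianalytic_stepCost hW hWb).lt_measurable
      ((hv.comp measurable_fst).add_const δ)
  obtain ⟨α, hα, hsel⟩ := hS.exists_measurable_ae_selection μ
  refine (iInf_le _ ⟨α, hα⟩).trans (EReal.coe_le_coe ?_)
  have hle : ∫ x, stepCost F f ρ W x (α x) ∂μ ≤
      ∫ x, ((⨅ a, stepCost F f ρ W x a) + δ) ∂μ := by
    refine integral_mono_ae (h.integral_stepCost hW hWb hα hμ).1
      (hVi.add (integrable_const δ)) ?_
    filter_upwards [hvae, hsel] with x hx hsx
    have hx' : ⨅ a, stepCost F f ρ W x a = v x := hx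
    obtain ⟨a, ha⟩ := exists_lt_of_ciInf_lt (show ⨅ a, stepCost F f ρ W x a < v x + δ by linarith)
    have : stepCost F f ρ W x (α x) < v x + δ := hsx ⟨a, ha⟩
    rw [hx']
    exact this.le
  rw [integral_add hVi (integrable_const δ)] at hle
  simp only [integral_const, probReal_univ, one_smul] at hle
  linarith

end IsQuadraticStep

/-! ### From the controlled system to one-step problems -/

theorem indepFun_prodMk_of_indepFun_prodMk {Ω S T U : Type*} [MeasurableSpace Ω]
    [MeasurableSpace S] [MeasurableSpace T] [MeasurableSpace U] {Pr : Measure Ω}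
    [IsProbabilityMeasure Pr] {X : Ω → S} {Y : Ω → T} {Z : Ω → U} (hX : Measurable X)
    (hY : Measurable Y) (hZ : Measurable Z) (h1 : IndepFun X (fun ω => (Y ω, Z ω)) Pr)
    (h2 : IndepFun Y Z Pr) : IndepFun (fun ω => (X ω, Y ω)) Z Pr := by
  have := Measure.isProbabilityMeasure_map (μ := Pr) hX.aemeasurable
  have := Measure.isProbabilityMeasure_map (μ := Pr) hY.aemeasurable
  have := Measure.isProbabilityMeasure_map (μ := Pr) hZ.aemeasurable
  have h3 : IndepFun X Y Pr := h1.comp measurable_id measurable_fst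
  have e1 := (indepFun_iff_map_prod_eq_prod_map_map hX.aemeasurable
    (hY.prodMk hZ).aemeasurable).1 h1
  have e2 := (indepFun_iff_map_prod_eq_prod_map_map hY.aemeasurable hZ.aemeasurable).1 h2
  have e3 := (indepFun_iff_map_prod_eq_prod_map_map hX.aemeasurable hY.aemeasurable).1 h3
  rw [indepFun_iff_map_prod_eq_prod_map_map (hX.prodMk hY).aemeasurable hZ.aemeasurable, e3]
  have e4 : Pr.map (fun ω => ((X ω, Y ω), Z ω)) =
      (Pr.map fun ω => (X ω, (Y ω, Z ω))).map MeasurableEquiv.prodAssoc.symm := by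
    rw [Measure.map_map MeasurableEquiv.prodAssoc.symm.measurable (hX.prodMk (hY.prodMk hZ))]
    rfl
  rw [e4, e1, e2, ← Measure.prodAssoc_prod, Measure.map_map
    MeasurableEquiv.prodAssoc.symm.measurable MeasurableEquiv.prodAssoc.measurable]
  simp

namespace McKeanVlasov

variable {Ω : Type*} [MeasurableSpace Ω] {Pr : Measure Ω}
  {E : Type*} [NormedAddCommGroup E] [MeasurableSpace E]
  {M : Type*} [NormedAddCommGroup M] [MeasurableSpace M] {A : Set M} {d n : ℕ}

theorem integrable_norm_sq_of_secondMoment_lt_top [OpensMeasurableSpace E]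
    {μ : ProbabilityMeasure E} (hμ : secondMoment (fun y => ‖y‖ₑ) μ < ∞) :
    Integrable (fun x => ‖x‖ ^ 2) (μ : Measure E) :=
  (integrable_norm_sq_of_lintegral_le aemeasurable_id hμ.ne le_rfl).1

theorem secondMoment_dirac {S : Type*} [MeasurableSpace S] [MeasurableSingletonClass S]
    (r : S → ℝ≥0∞) (x : S) :
    secondMoment r ⟨Measure.dirac x, Measure.dirac.isProbabilityMeasure⟩ = r x ^ 2 := by
  simp [secondMoment]

/-- Boundedness of `A` makes linear growth automatic, so measurable selectors are admissible
policies. -/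
theorem exists_policy_of_isBounded (hA : Bornology.IsBounded A) {α : E → A} (hα : Measurable α) :
    ∃ β : Policy E A, β.1 = α := by
  obtain ⟨R, hR0, hR⟩ := hA.exists_pos_norm_le
  refine ⟨⟨α, hα, R, fun x => (hR _ (α x).2).trans ?_⟩, rfl⟩
  exact le_mul_of_one_le_right hR0.le (by linarith [norm_nonneg x])

namespace System

variable {m : System Pr E A d n}
  {F₀ : ℕ → E → A → EuclideanSpace ℝ (Fin d) → E} {f₀ : ℕ → E → A → ℝ} {g₀ : E → ℝ}

theorem indepFun_X [IsProbabilityMeasure Pr] (m : System Pr E A d n) (β : ℕ → Policy E A) (k : ℕ) :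
    IndepFun (m.X β k).1 (m.ε k) Pr := by
  -- The laws entering the recursion are constants, so the state at time `k` is a measurable
  -- function of `ξ` and the noises of index below `k`.
  have hX : ∀ k, ∃ G : E × (Finset.range k → EuclideanSpace ℝ (Fin d)) → E, Measurable G ∧
      ∀ ω, (m.X β k).1 ω = G (m.ξ ω, fun i => m.ε i ω) := by
    intro k
    induction k with
    | zero => exact ⟨Prod.fst, measurable_fst, fun _ => rfl⟩
    | succ k ih =>
      obtain ⟨G, hG, hGX⟩ := ih
      let r : E × (Finset.range (k + 1) → EuclideanSpace ℝ (Fin d)) →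
          E × (Finset.range k → EuclideanSpace ℝ (Fin d)) :=
        fun p => (p.1, fun i => p.2 ⟨i, Finset.mem_range.2
          ((Finset.mem_range.1 i.2).trans (Nat.lt_succ_self k))⟩)
      have hr : Measurable r := by fun_prop
      have hGr := hG.comp hr
      let U : {U : Ω → A // Measurable U} :=
        ⟨fun ω => (β k).1 ((m.X β k).1 ω), (β k).2.1.comp (m.X β k).2⟩
      refine ⟨fun p => m.F k (G (r p)) (law Pr (m.X β k)) ((β k).1 (G (r p))) (law Pr U)
        (p.2 ⟨k, Finset.self_mem_range_succ k⟩), ?_, fun ω => ?_⟩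
      · exact (m.measurable_F k).comp (hGr.prodMk (measurable_const.prodMk
          (((β k).2.1.comp hGr).prodMk (measurable_const.prodMk
            ((measurable_pi_apply (⟨k, Finset.self_mem_range_succ k⟩ :
              Finset.range (k + 1))).comp measurable_snd)))))
      · change m.F k ((m.X β k).1 ω) _ ((β k).1 ((m.X β k).1 ω)) _ (m.ε k ω) = _
        rw [hGX ω]
  obtain ⟨G, hG, hGX⟩ := hX k
  have hfin : IndepFun (fun ω (i : Finset.range k) => m.ε i ω) (m.ε k) Pr :=
    (m.iIndepFun_ε.indepFun_finset (Finset.range k) {k} (by simp) m.measurable_ε).comp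
      measurable_id (measurable_pi_apply (⟨k, Finset.mem_singleton_self k⟩ : ({k} : Finset ℕ)))
  have hξ : IndepFun m.ξ (fun ω => ((fun i : Finset.range k => m.ε i ω), m.ε k ω)) Pr :=
    m.indepFun_ξ_ε.comp measurable_id
      (show Measurable fun e : ℕ → EuclideanSpace ℝ (Fin d) =>
        ((fun i : Finset.range k => e i), e k) by fun_prop)
  have h := indepFun_prodMk_of_indepFun_prodMk m.measurable_ξ
    (measurable_pi_lambda _ fun i : Finset.range k => m.measurable_ε i) (m.measurable_ε k) hξ hfin
  have hXG : (m.X β k).1 = G ∘ fun ω => (m.ξ ω, fun i : Finset.range k => m.ε i ω) :=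
    funext hGX
  rw [hXG]
  exact h.comp hG measurable_id

theorem law_X_succ [IsProbabilityMeasure Pr] (m : System Pr E A d n)
    (hF : ∀ k x μ a l e, m.F k x μ a l e = F₀ k x a e)
    (β : ℕ → Policy E A) {k : ℕ}
    (hm : Measurable fun p : E × EuclideanSpace ℝ (Fin d) => F₀ k p.1 ((β k).1 p.1) p.2) :
    (law Pr (m.X β (k + 1)) : Measure E) =
      ((law Pr (m.X β k) : Measure E).prod (Pr.map (m.ε k))).map
        fun p => F₀ k p.1 ((β k).1 p.1) p.2 := by
  have h := (indepFun_iff_map_prod_eq_prod_map_map (m.X β k).2.aemeasurable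
    (m.measurable_ε k).aemeasurable).1 (m.indepFun_X β k)
  change Pr.map (m.X β (k + 1)).1 = ((Pr.map (m.X β k).1).prod (Pr.map (m.ε k))).map _
  rw [← h, Measure.map_map hm ((m.X β k).2.prodMk (m.measurable_ε k))]
  congr 1
  ext ω
  exact hF _ _ _ _ _ _

theorem coe_Phi [IsProbabilityMeasure Pr] (m : System Pr E A d n)
    (hF : ∀ k x μ a l e, m.F k x μ a l e = F₀ k x a e)
    (μ : ProbabilityMeasure E) (α : Policy E A) {k : ℕ}
    (hm : Measurable fun p : E × EuclideanSpace ℝ (Fin d) => F₀ k p.1 (α.1 p.1) p.2) :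
    (m.Phi k μ α : Measure E) =
      ((μ : Measure E).prod (Pr.map (m.ε k))).map fun p => F₀ k p.1 (α.1 p.1) p.2 := by
  have := Measure.isProbabilityMeasure_map (μ := Pr) (m.measurable_ε k).aemeasurable
  ext s hs
  rw [Measure.map_apply hm hs, Measure.prod_apply (hm hs)]
  change (μ : Measure E).bind _ s = _
  rw [Measure.bind_apply hs (m.measurable_P k μ α (α.push μ)).aemeasurable]
  refine lintegral_congr fun x => ?_
  have hP : m.P k x μ (α.1 x) (α.push μ) = Pr.map fun ω => F₀ k x (α.1 x) (m.ε k ω) := by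
    simp only [P, hF]
  have hx : Measurable fun ω => F₀ k x (α.1 x) (m.ε k ω) :=
    (hm.comp measurable_prodMk_left).comp (m.measurable_ε k)
  rw [hP, Measure.map_apply (m.measurable_ε k) (measurable_prodMk_left (hm hs)),
    Measure.map_apply hx hs]
  rfl

theorem measurable_terminalCost (m : System Pr E A d n) (hg : ∀ x μ, m.g x μ = g₀ x) :
    Measurable g₀ := by
  let μ₀ : ProbabilityMeasure E := ⟨Measure.dirac 0, Measure.dirac.isProbabilityMeasure⟩
  have := m.measurable_g.comp (f := fun x : E => (x, μ₀)) (by fun_prop)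
  simpa only [Function.comp_def, hg] using this

theorem hasQuadraticGrowth_terminalCost [MeasurableSingletonClass E] (hH2 : m.H2)
    (hg : ∀ x μ, m.g x μ = g₀ x) :
    HasQuadraticGrowth g₀ := by
  obtain ⟨C, hC0, hC⟩ := hH2.2
  refine ⟨C, hC0.le, fun x => ?_⟩
  let μ₀ : ProbabilityMeasure E := ⟨Measure.dirac 0, Measure.dirac.isProbabilityMeasure⟩
  have h := hC x μ₀ (by simp [μ₀, secondMoment_dirac])
  rw [hg, secondMoment_dirac] at h
  simpa using h

variable [BorelSpace E] [StandardBorelSpace E] [StandardBorelSpace A]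

theorem exists_integral_sq_le_of_H1 (hAb : Bornology.IsBounded A) (hH1 : m.H1)
    (hF : ∀ k x μ a l e, m.F k x μ a l e = F₀ k x a e)
    (k : ℕ) : ∃ C : ℝ, 0 ≤ C ∧ ∀ x a,
      Integrable (fun e => ‖F₀ k x a e‖ ^ 2) (Pr.map (m.ε k)) ∧
      ∫ e, ‖F₀ k x a e‖ ^ 2 ∂(Pr.map (m.ε k)) ≤ C * (1 + ‖x‖ ^ 2) := by
  obtain ⟨R, hR0, hR⟩ := hAb.exists_pos_norm_le
  obtain ⟨C, -, hC⟩ := hH1 k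
  -- (H1) is evaluated at the Dirac masses at `0` and at `a`: the first adds nothing, the second
  -- adds another `|a|² ≤ R²`.
  refine ⟨C * (1 + 2 * R ^ 2), by positivity, fun x a => ?_⟩
  let μ₀ : ProbabilityMeasure E := ⟨Measure.dirac 0, Measure.dirac.isProbabilityMeasure⟩
  let l₀ : ProbabilityMeasure A := ⟨Measure.dirac a, Measure.dirac.isProbabilityMeasure⟩
  have h := hC x μ₀ a l₀
  rw [secondMoment_dirac, secondMoment_dirac] at h
  have hFm : Measurable (F₀ k x a) := by
    have := (m.measurable_F k).comp (measurable_const (a := x).prodMk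
      (measurable_const (a := μ₀).prodMk (measurable_const (a := a).prodMk
        (measurable_const (a := l₀).prodMk measurable_id))))
    simpa only [Function.comp_def, hF, id] using this
  simp only [hF] at h
  have hu := hFm.comp (m.measurable_ε k)
  obtain ⟨h1, h2⟩ := integrable_norm_sq_of_lintegral_le hu.aemeasurable
    (by simp [ENNReal.mul_eq_top]) h
  have hsq : Measurable fun e => ‖F₀ k x a e‖ ^ 2 := by fun_prop
  rw [integrable_map_measure hsq.aestronglyMeasurable (m.measurable_ε k).aemeasurable,
    integral_map (m.measurable_ε k).aemeasurable hsq.aestronglyMeasurable]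
  refine ⟨h1, h2.trans ?_⟩
  have ha : ‖(a : M)‖ ^ 2 ≤ R ^ 2 := by gcongr; exact hR _ a.2
  have hval : ((C : ℝ≥0∞) * (1 + ‖x‖ₑ ^ 2 + ‖(a : M)‖ₑ ^ 2 + ‖(0 : E)‖ₑ ^ 2
      + ‖(a : M)‖ₑ ^ 2)).toReal = C * (1 + ‖x‖ ^ 2 + ‖(a : M)‖ ^ 2 + ‖(a : M)‖ ^ 2) := by
    rw [ENNReal.toReal_mul, ENNReal.toReal_add (by simp) (by simp),
      ENNReal.toReal_add (by simp) (by simp), ENNReal.toReal_add (by simp) (by simp),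
      ENNReal.toReal_add (by simp) (by simp)]
    simp
  rw [hval, mul_assoc]
  gcongr
  nlinarith [sq_nonneg ‖x‖, mul_nonneg (sq_nonneg R) (sq_nonneg ‖x‖)]

theorem isQuadraticStep (hAb : Bornology.IsBounded A) (hH1 : m.H1) (hH2 : m.H2)
    (hF : ∀ k x μ a l e, m.F k x μ a l e = F₀ k x a e)
    (hf : ∀ k < n, ∀ x μ a l, m.f k x μ a l = f₀ k x a) {k : ℕ} (hk : k < n) [Nonempty A] :
    IsQuadraticStep (F₀ k) (f₀ k) (Pr.map (m.ε k)) where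
  measurable_F := by
    let μ₀ : ProbabilityMeasure E := ⟨Measure.dirac 0, Measure.dirac.isProbabilityMeasure⟩
    let l₀ : ProbabilityMeasure A :=
      ⟨Measure.dirac (Classical.arbitrary A), Measure.dirac.isProbabilityMeasure⟩
    have := (m.measurable_F k).comp (f := fun p : (E × A) × EuclideanSpace ℝ (Fin d) =>
      (p.1.1, μ₀, p.1.2, l₀, p.2)) (by fun_prop)
    simpa only [Function.comp_def, hF] using this
  measurable_f := by
    let μ₀ : ProbabilityMeasure E := ⟨Measure.dirac 0, Measure.dirac.isProbabilityMeasure⟩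
    let l₀ : ProbabilityMeasure A :=
      ⟨Measure.dirac (Classical.arbitrary A), Measure.dirac.isProbabilityMeasure⟩
    have := (m.measurable_f k hk).comp (f := fun p : E × A => (p.1, μ₀, p.2, l₀)) (by fun_prop)
    simpa only [Function.comp_def, hf k hk] using this
  integrable_sq x a := by
    obtain ⟨C, -, hC⟩ := exists_integral_sq_le_of_H1 hAb hH1 hF k
    exact (hC x a).1
  exists_integral_sq_le := by
    obtain ⟨C, hC0, hC⟩ := exists_integral_sq_le_of_H1 hAb hH1 hF k
    exact ⟨C, hC0, fun x a => (hC x a).2⟩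
  exists_abs_le := by
    obtain ⟨R, hR0, hR⟩ := hAb.exists_pos_norm_le
    obtain ⟨C, hC0, hC⟩ := hH2.1 k hk
    refine ⟨C * (1 + 2 * R ^ 2), by positivity, fun x a => ?_⟩
    let μ₀ : ProbabilityMeasure E := ⟨Measure.dirac 0, Measure.dirac.isProbabilityMeasure⟩
    let l₀ : ProbabilityMeasure A := ⟨Measure.dirac a, Measure.dirac.isProbabilityMeasure⟩
    have h := hC x μ₀ a l₀ (by simp [μ₀, secondMoment_dirac]) (by simp [l₀, secondMoment_dirac])
    rw [hf k hk, secondMoment_dirac, secondMoment_dirac] at h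
    simp only [enorm_zero, ENNReal.toReal_pow, toReal_enorm] at h
    refine h.trans ?_
    have ha : ‖(a : M)‖ ^ 2 ≤ R ^ 2 := by gcongr; exact hR _ a.2
    rw [mul_assoc]
    gcongr
    simp only [ne_eq, OfNat.ofNat_ne_zero, not_false_eq_true, zero_pow, ENNReal.toReal_zero]
    nlinarith [sq_nonneg ‖x‖, mul_nonneg (sq_nonneg R) (sq_nonneg ‖x‖)]

end System

end McKeanVlasov

/-! ### Backward induction and finiteness of the value -/

namespace McKeanVlasov

variable {Ω : Type*} [MeasurableSpace Ω] {Pr : Measure Ω} [IsProbabilityMeasure Pr]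
  {E : Type*} [NormedAddCommGroup E] [MeasurableSpace E]
  {M : Type*} [NormedAddCommGroup M] [MeasurableSpace M] {A : Set M} {d n : ℕ}

namespace System

/-- The optimal cost of the problem without mean-field interaction, as a function of the number of
remaining time steps and of the current state. -/
noncomputable def optimalCostToGo (m : System Pr E A d n)
    (F₀ : ℕ → E → A → EuclideanSpace ℝ (Fin d) → E) (f₀ : ℕ → E → A → ℝ) (g₀ : E → ℝ) :
    ℕ → E → ℝ
  | 0 => g₀
  | j + 1 => fun x => ⨅ a, stepCost (F₀ (n - (j + 1))) (f₀ (n - (j + 1)))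
      (Pr.map (m.ε (n - (j + 1)))) (optimalCostToGo m F₀ f₀ g₀ j) x a

variable [BorelSpace E] [StandardBorelSpace E]
  {m : System Pr E A d n}
  {F₀ : ℕ → E → A → EuclideanSpace ℝ (Fin d) → E} {f₀ : ℕ → E → A → ℝ} {g₀ : E → ℝ}

/-- The bound must not depend on the controls, because `V` is an infimum over all of them; the step
constants are uniform in `a`. -/
theorem exists_integral_sq_law_X_le (hF : ∀ k x μ a l e, m.F k x μ a l e = F₀ k x a e)
    (hstep : ∀ k < n, IsQuadraticStep (F₀ k) (f₀ k) (Pr.map (m.ε k))) (k : ℕ) (hk : k ≤ n) :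
    ∃ C : ℝ, ∀ β : ℕ → Policy E A,
      Integrable (fun x => ‖x‖ ^ 2) (law Pr (m.X β k) : Measure E) ∧
      ∫ x, ‖x‖ ^ 2 ∂(law Pr (m.X β k) : Measure E) ≤ C := by
  induction k with
  | zero =>
    refine ⟨_, fun β => integrable_norm_sq_of_lintegral_le aemeasurable_id
      m.sq_integrable_ξ.ne ?_⟩
    change ∫⁻ x, ‖x‖ₑ ^ 2 ∂(Pr.map m.ξ) ≤ _
    rw [lintegral_map (by fun_prop) m.measurable_ξ]
  | succ k ih =>
    obtain ⟨C, hC⟩ := ih (by omega)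
    have hs := hstep k (by omega)
    obtain ⟨D, hD0, hD⟩ := hs.exists_integral_sq_le
    have := Measure.isProbabilityMeasure_map (μ := Pr) (m.measurable_ε k).aemeasurable
    refine ⟨D * (1 + C), fun β => ?_⟩
    rw [m.law_X_succ hF β (hs.measurable_policy (β k).2.1)]
    refine ⟨hs.map_integrable_sq (β k).2.1 (hC β).1,
      (hs.integral_sq_map_le hD (β k).2.1 (hC β).1).trans ?_⟩
    gcongr
    exact (hC β).2

theorem bot_lt_V (hF : ∀ k x μ a l e, m.F k x μ a l e = F₀ k x a e)
    (hf : ∀ k < n, ∀ x μ a l, m.f k x μ a l = f₀ k x a) (hg : ∀ x μ, m.g x μ = g₀ x)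
    (hstep : ∀ k < n, IsQuadraticStep (F₀ k) (f₀ k) (Pr.map (m.ε k)))
    (hgb : HasQuadraticGrowth g₀) (k : ℕ) (α : ℕ → Policy E A) : ⊥ < m.V k α := by
  have hmom := exists_integral_sq_law_X_le (m := m) hF hstep
  -- The constant precedes `j < n` so that `choose` yields lower bounds indexed by all of `ℕ`.
  have hfb : ∀ j, ∃ C : ℝ, j < n → ∀ β : ℕ → Policy E A,
      C ≤ m.fhat j (law Pr (m.X β j)) (β j) := fun j => by
    by_cases hj : j < n
    · obtain ⟨C, hC⟩ := hmom j hj.le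
      obtain ⟨D, hD0, hD⟩ := (hstep j hj).exists_abs_le
      refine ⟨-(D * (1 + C)), fun _ β => ?_⟩
      have h := abs_integral_le_of_abs_le_quadratic (fun x => hD x ((β j).1 x)) (hC β).1
      have h2 : D * (1 + ∫ x, ‖x‖ ^ 2 ∂(law Pr (m.X β j) : Measure E)) ≤ D * (1 + C) := by
        gcongr
        exact (hC β).2
      simp only [fhat, hf j hj]
      linarith [(abs_le.1 h).1]
    · exact ⟨0, fun h => absurd h hj⟩
  choose B hB using hfb
  obtain ⟨C, hC⟩ := hmom n le_rfl
  obtain ⟨D, hD0, hD⟩ := hgb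
  have hgl : ∀ β : ℕ → Policy E A, -(D * (1 + C)) ≤ m.ghat (law Pr (m.X β n)) := fun β => by
    have h := abs_integral_le_of_abs_le_quadratic hD (hC β).1
    have h2 : D * (1 + ∫ x, ‖x‖ ^ 2 ∂(law Pr (m.X β n) : Measure E)) ≤ D * (1 + C) := by
      gcongr
      exact (hC β).2
    simp only [ghat, hg]
    linarith [(abs_le.1 h).1]
  refine (EReal.bot_lt_coe (∑ j ∈ Finset.Ico k n, B j + -(D * (1 + C)))).trans_le
    (le_iInf fun β => EReal.coe_le_coe (add_le_add (Finset.sum_le_sum fun j hj => ?_) (hgl β.1)))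
  exact hB j (Finset.mem_Ico.1 hj).2 β.1

variable [StandardBorelSpace A] [Nonempty A]

/-- The three assertions are proved together: exchanging infimum and integral at one step needs
semianalyticity and growth of the cost at the next. -/
theorem valueToGo_eq_integral_optimalCostToGo (hAb : Bornology.IsBounded A)
    (hF : ∀ k x μ a l e, m.F k x μ a l e = F₀ k x a e)
    (hf : ∀ k < n, ∀ x μ a l, m.f k x μ a l = f₀ k x a) (hg : ∀ x μ, m.g x μ = g₀ x)
    (hstep : ∀ k < n, IsQuadraticStep (F₀ k) (f₀ k) (Pr.map (m.ε k)))
    (hgm : Measurable g₀) (hgb : HasQuadraticGrowth g₀) (j : ℕ) (hj : j ≤ n) :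
    IsLowerSemianalytic (m.optimalCostToGo F₀ f₀ g₀ j) ∧
    HasQuadraticGrowth (m.optimalCostToGo F₀ f₀ g₀ j) ∧
    ∀ μ : ProbabilityMeasure E, Integrable (fun x => ‖x‖ ^ 2) (μ : Measure E) →
      m.valueToGo j μ = ((∫ x, m.optimalCostToGo F₀ f₀ g₀ j x ∂(μ : Measure E) : ℝ) : EReal) := by
  induction j with
  | zero =>
    refine ⟨hgm.isLowerSemianalytic, hgb, fun μ _ => ?_⟩
    simp only [valueToGo, optimalCostToGo, ghat, hg]
  | succ j ih =>
    obtain ⟨hW, hWb, hWv⟩ := ih (by omega)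
    set k := n - (j + 1) with hk
    have hkn : k < n := by omega
    have := Measure.isProbabilityMeasure_map (μ := Pr) (m.measurable_ε k).aemeasurable
    have hs := hstep k hkn
    refine ⟨hs.isLowerSemianalytic_iInf hW hWb, hs.hasQuadraticGrowth_iInf hWb, fun μ hμ => ?_⟩
    -- The next law is again square integrable, so the induction hypothesis applies and the bracket
    -- becomes one integral.
    have hval : ∀ α : Policy E A, ((m.fhat k μ α : ℝ) : EReal) + m.valueToGo j (m.Phi k μ α) =
        ((∫ x, stepCost (F₀ k) (f₀ k) (Pr.map (m.ε k)) (m.optimalCostToGo F₀ f₀ g₀ j) x (α.1 x)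
          ∂(μ : Measure E) : ℝ) : EReal) := fun α => by
      have hΦ := m.coe_Phi hF μ α (hs.measurable_policy α.2.1)
      rw [hWv _ (by rw [hΦ]; exact hs.map_integrable_sq α.2.1 hμ), hΦ, ← EReal.coe_add,
        (hs.integral_stepCost hW hWb α.2.1 hμ).2]
      simp only [fhat, hf k hkn]
    calc m.valueToGo (j + 1) μ
        = ⨅ α : Policy E A, ((m.fhat k μ α : ℝ) : EReal) + m.valueToGo j (m.Phi k μ α) := rfl
      _ = ⨅ α : {α : E → A // Measurable α}, ((∫ x, stepCost (F₀ k) (f₀ k) (Pr.map (m.ε k))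
            (m.optimalCostToGo F₀ f₀ g₀ j) x (α.1 x) ∂(μ : Measure E) : ℝ) : EReal) := by
          refine le_antisymm (le_iInf fun α => ?_) (le_iInf fun α => ?_)
          · obtain ⟨β, hβ⟩ := exists_policy_of_isBounded hAb α.2
            refine (iInf_le _ β).trans_eq ?_
            rw [hval β, hβ]
          · rw [hval α]
            exact iInf_le_of_le ⟨α.1, α.2.1⟩ le_rfl
      _ = _ := (hs.coe_integral_iInf_stepCost hW hWb hμ).symm

end System

end McKeanVlasov

end

theorem mainTheorem7
    {Ω : Type*} [MeasurableSpace Ω] (Pr : Measure Ω) [IsProbabilityMeasure Pr]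
    {E : Type*} [NormedAddCommGroup E] [NormedSpace ℝ E] [MeasurableSpace E] [BorelSpace E]
    [StandardBorelSpace E]
    {M : Type*} [NormedAddCommGroup M] [NormedSpace ℝ M] [MeasurableSpace M] [BorelSpace M]
    (A : Set M) (hA : A.Nonempty) (hAb : Bornology.IsBounded A) [StandardBorelSpace A]
    (d n : ℕ) (hn : 0 < n)
    (m : McKeanVlasov.System Pr E A d n) (hH1 : m.H1) (hH2 : m.H2)
    -- no mean-field interaction: the coefficients do not depend on the measure arguments
    (F₀ : ℕ → E → A → EuclideanSpace ℝ (Fin d) → E) (f₀ : ℕ → E → A → ℝ) (g₀ : E → ℝ)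
    (hF : ∀ k x μ a l e, m.F k x μ a l e = F₀ k x a e)
    (hf : ∀ k < n, ∀ x μ a l, m.f k x μ a l = f₀ k x a)
    (hg : ∀ x μ, m.g x μ = g₀ x) :
    -- the finiteness condition
    (∀ k ≤ n, ∀ α : ℕ → McKeanVlasov.Policy E A, ⊥ < m.V k α) ∧
    ∃ w : ℕ → E → ℝ,
      -- the classical dynamic programming principle; the law of `F₀ k x a (ε k)` is the
      -- transition probability from time `k` to time `k + 1`
      (∀ x, w n x = g₀ x) ∧
      (∀ k < n, ∀ x a, Integrable (w (k + 1)) (Pr.map (fun ω => F₀ k x a (m.ε k ω)))) ∧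
      (∀ k < n, ∀ x, (w k x : EReal) = ⨅ a : A,
        ((f₀ k x a + ∫ x', w (k + 1) x' ∂(Pr.map (fun ω => F₀ k x a (m.ε k ω))) : ℝ) : EReal)) ∧
      -- the value functions are linear in the measure
      (∀ k ≤ n, ∀ μ : ProbabilityMeasure E,
        McKeanVlasov.secondMoment (fun y => ‖y‖ₑ) μ < ∞ →
        Integrable (w k) (μ : Measure E) ∧
        m.v k μ = ((∫ x, w k x ∂(μ : Measure E) : ℝ) : EReal)) := by
  have : Nonempty A := hA.to_subtype
  have hstep : ∀ k < n, IsQuadraticStep (F₀ k) (f₀ k) (Pr.map (m.ε k)) := fun k hk =>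
    McKeanVlasov.System.isQuadraticStep hAb hH1 hH2 hF hf hk
  have hgm := m.measurable_terminalCost hg
  have hgb := McKeanVlasov.System.hasQuadraticGrowth_terminalCost hH2 hg
  have hρ : ∀ k, IsProbabilityMeasure (Pr.map (m.ε k)) := fun k =>
    Measure.isProbabilityMeasure_map (m.measurable_ε k).aemeasurable
  have hval := McKeanVlasov.System.valueToGo_eq_integral_optimalCostToGo hAb hF hf hg hstep hgm hgb
  have hmap : ∀ k < n, ∀ x a, Pr.map (fun ω => F₀ k x a (m.ε k ω)) =
      (Pr.map (m.ε k)).map (F₀ k x a) := fun k hk x a =>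
    (Measure.map_map ((hstep k hk).measurable_section x a) (m.measurable_ε k)).symm
  refine ⟨fun k _ α => McKeanVlasov.System.bot_lt_V hF hf hg hstep hgb k α,
    fun k => m.optimalCostToGo F₀ f₀ g₀ (n - k), fun x => ?_, fun k hk x a => ?_,
    fun k hk x => ?_, fun k hk μ hμ => ?_⟩
  · simp [McKeanVlasov.System.optimalCostToGo]
  · obtain ⟨hW, hWb, -⟩ := hval (n - (k + 1)) (by omega)
    have hFm := ((hstep k hk).measurable_section x a).aemeasurable (μ := Pr.map (m.ε k))
    -- Lower semianalyticity provides measurability for the completion of the transition law, as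
    -- required here.
    rw [hmap k hk, integrable_map_measure
      (hW.aemeasurable _).aestronglyMeasurable hFm]
    exact (hstep k hk).integrable_comp hW hWb x a
  · obtain ⟨hW, hWb, -⟩ := hval (n - (k + 1)) (by omega)
    have h1 : n - k = (n - (k + 1)) + 1 := by omega
    have h2 : n - ((n - (k + 1)) + 1) = k := by omega
    simp only [h1, McKeanVlasov.System.optimalCostToGo]
    rw [h2, (hstep k hk).coe_iInf_stepCost hWb x]
    refine iInf_congr fun a => ?_
    have hFm := ((hstep k hk).measurable_section x a).aemeasurable (μ := Pr.map (m.ε k))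
    rw [hmap k hk, integral_map hFm (hW.aemeasurable _).aestronglyMeasurable]
    rfl
  · obtain ⟨hW, hWb, hv⟩ := hval (n - k) (by omega)
    have hμ' := McKeanVlasov.integrable_norm_sq_of_secondMoment_lt_top hμ
    exact ⟨hWb.integrable (hW.aemeasurable _) hμ', hv μ hμ'⟩
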